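/- **Theorem 3 (Asymptotic normality of sliced score matching).** Let $\Theta\subset\mathbb R^d$ be compact, let $\{p_m(\cdot;\theta):\theta\in\Theta\}$ be strictly positive probability densities on $\mathbb R^D$, let $p_d$ be the data density and $p_{\mathbf v}$ a probability distribution on $\mathbb R^D$. Write $l_m=\log p_m$, $\mathbf s_m(\mathbf x;\theta)=\nabla_{\mathbf x} l_m(\mathbf x;\theta)$, $\partial_i=\partial/\partial x_i$, $f(\theta;\mathbf x,\mathbf v)=\mathbf v^\top\nabla_{\mathbf x}\mathbf s_m(\mathbf x;\theta)\mathbf v+\tfrac12(\mathbf v^\top\mathbf s_m(\mathbf x;\theta))^2$, and $$J(\theta;p_{\mathbf v})=\mathbb E_{p_{\mathbf v}}\mathbb E_{p_d}[f(\theta;\mathbf x,\mathbf v)],\qquad J(\theta)=\mathbb E_{p_d}\big[\operatorname{tr}\nabla_{\mathbf x}\mathbf s_m(\mathbf x;\theta)+\tfrac12\|\mathbf s_m(\mathbf x;\theta)\|_2^2\big].$$ Assume: 1. for every $\theta\in\Theta$, $l_m(\cdot;\theta)$ and $\mathbf s_m(\cdot;\theta)$ are differentiable, $\mathbb E_{p_d}\|\mathbf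 s_m(\mathbf x;\theta)\|_2^2<\infty$, $\mathbf s_m(\mathbf x;\theta)p_d(\mathbf x)\to0$ as $\|\mathbf x\|\to\infty$, and $f(\theta;\mathbf x,\mathbf v)$ is integrable under $p_d\otimes p_{\mathbf v}$ (so that $J(\theta;p_{\mathbf v})$ is well defined); 2. $\mathbb E_{p_{\mathbf v}}\|\mathbf v\|_2^2<\infty$, $\mathbb E_{p_{\mathbf v}}[\mathbf v\mathbf v^\top]\succ0$ and $\mathbb E_{p_{\mathbf v}}\|\mathbf v\mathbf v^\top\|_F^2<\infty$; 3. $p_d=p_m(\cdot;\theta^*)$ for some $\theta^*$ in the interior of $\Theta$, and $p_m(\cdot;\theta)\ne p_m(\cdot;\theta^*)$ for all $\theta\in\Theta$ with $\theta\neq\theta^*$; 4. there are $L_1,L_2$ with $\mathbb E_{p_d}[L_1^2]<\infty$, $\mathbb E_{p_d}[L_2^2]<\infty$ such that for all $\theta_1,\theta_2\in\Theta$ and all $\mathbf x$, $\|\nabla_{\mathbf x}\mathbf s_m(\mathbf x;\theta_1)-\nabla_{\mathbf x}\mathbf s_m(\mathbf x;\theta_2)\|_F\le L_1(\mathbf x)\|\theta_1-\theta_2\|_2$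 and $\|\mathbf s_m(\mathbf x;\theta_1)\mathbf s_m(\mathbf x;\theta_1)^\top-\mathbf s_m(\mathbf x;\theta_2)\mathbf s_m(\mathbf x;\theta_2)^\top\|_F\le L_2(\mathbf x)\|\theta_1-\theta_2\|_2$; 5. on some ball around $\theta^*$ and for all $i,j$ and $\mathbf x$, the functions $\theta\mapsto\partial_i\partial_j l_m(\mathbf x;\theta)$ and $\theta\mapsto\partial_i l_m(\mathbf x;\theta)\,\partial_j l_m(\mathbf x;\theta)$ are $C^2$, and their $\theta$-Hessians are Lipschitz in $\theta$ in Frobenius norm with constants $M_{ij}(\mathbf x)$ and $N_{ij}(\mathbf x)$ respectively, where $\mathbb E_{p_d}[M_{ij}^2]<\infty$ and $\mathbb E_{p_d}[N_{ij}^2]<\infty$; 6. the matrix $H=\nabla_\theta^2J(\theta^*;p_{\mathbf v})$ is invertible. Fix $M\ge1$. Let $\mathbf x_1,\mathbf x_2,\dots$ be i.i.d. from $p_d$ and, independently of them, let $\mathbf v_{ij}$ ($i\ge1$, $1\le j\le M$) be i.i.d. from $p_{\mathbf v}$; for each $N\ge 1$ let $\hat\theta_{N,M}$ be a (measurable) minimizer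 over $\Theta$ of $\frac1{NM}\sum_{i=1}^N\sum_{j=1}^M f(\theta;\mathbf x_i,\mathbf v_{ij})$. Put $\Sigma_{ij}=\mathbb E_{p_{\mathbf v}}[v_iv_j]$, $\mathfrak S_{ijpq}=\mathbb E_{p_{\mathbf v}}[v_iv_jv_pv_q]$, $g_{ij}(\mathbf x)=\big(\nabla_\theta\partial_i\partial_jl_m+\tfrac12\nabla_\theta(\partial_il_m\,\partial_jl_m)\big)(\mathbf x;\theta^*)$, $\mathfrak V_{ijpq}=\mathbb E_{p_d}[g_{ij}(\mathbf x)g_{pq}(\mathbf x)^\top]$, $V_{ij}=\mathfrak V_{iijj}$ and $W_{ij}=\mathfrak V_{ijij}$. Then, as $N\to\infty$, $$\sqrt N(\hat\theta_{N,M}-\theta^*)\overset{d}{\to}\mathcal N\Big(0,\;H^{-1}\Big(\sum_{i,j,p,q}\Big[\Big(1-\frac1M\Big)\Sigma_{ij}\Sigma_{pq}+\frac1M\mathfrak S_{ijpq}\Big]\mathfrak V_{ijpq}\Big)H^{-1}\Big).$$ In particular, if $p_{\mathbf v}=\mathcal N(0,I)$, the asymptotic covariance is $$[\nabla_\theta^2J(\theta^*)]^{-1}\Big(\sum_{i,j}V_{ij}+\frac2M\sum_iV_{ii}+\frac2M\sum_{i\ne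 j}W_{ij}\Big)[\nabla_\theta^2J(\theta^*)]^{-1},$$ and if $p_{\mathbf v}$ is the multivariate Rademacher distribution (uniform on $\{\pm1\}^D$), it is $$[\nabla_\theta^2J(\theta^*)]^{-1}\Big(\sum_{i,j}V_{ij}+\frac2M\sum_{i\ne j}W_{ij}\Big)[\nabla_\theta^2J(\theta^*)]^{-1}.$$ (Each of these matrices is positive semidefinite.) -/

import Mathlib

open MeasureTheory ProbabilityTheory Filter Topology

namespace SlicedScoreMatching

noncomputable section

/-- `ℝⁿ` with the Euclidean norm. -/
abbrev E (n : ℕ) : Type := EuclideanSpace ℝ (Fin n)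

/-- The Hessian matrix `∇² h (x)`; its `(i, j)` entry is `∂ᵢ ∂ⱼ h (x)`. -/
def hess {n : ℕ} (h : E n → ℝ) (x : E n) : Matrix (Fin n) (Fin n) ℝ :=
  Matrix.of fun i j => (fderiv ℝ (gradient h) x (EuclideanSpace.single i 1)) j

open scoped Matrix.Norms.Frobenius in
/-- The Frobenius norm of a real matrix. -/
def frobeniusNorm {m n : ℕ} (A : Matrix (Fin m) (Fin n) ℝ) : ℝ := ‖A‖

/-- The matrix `v vᵀ`. -/
def outer {n : ℕ} (v : E n) : Matrix (Fin n) (Fin n) ℝ := Matrix.of fun i j => v i * v j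

/-- The probability measure on `ℝᴰ` with Lebesgue density `p`. -/
def densityMeasure {D : ℕ} (p : E D → ℝ) : Measure (E D) :=
  volume.withDensity fun x => ENNReal.ofReal (p x)

section Model

variable {d D : ℕ} (pm : E d → E D → ℝ)

/-- The log-density `l_m(x; θ) = log p_m(x; θ)`. -/
def logDensity (θ : E d) (x : E D) : ℝ := Real.log (pm θ x)

/-- The score `s_m(x; θ) = ∇ₓ log p_m(x; θ)`. -/
def score (θ : E d) (x : E D) : E D := gradient (logDensity pm θ) x

/-- The matrix `∇ₓ s_m(x; θ) = ∇ₓ² log p_m(x; θ)`, with entries `∂ᵢ ∂ⱼ l_m(x; θ)`. -/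
def scoreJacobian (θ : E d) (x : E D) : Matrix (Fin D) (Fin D) ℝ := hess (logDensity pm θ) x

/-- The function `θ ↦ ∂ᵢ ∂ⱼ l_m(x; θ)`. -/
def secondPartial (x : E D) (i j : Fin D) (θ : E d) : ℝ := scoreJacobian pm θ x i j

/-- The function `θ ↦ ∂ᵢ l_m(x; θ) ∂ⱼ l_m(x; θ)`. -/
def partialProd (x : E D) (i j : Fin D) (θ : E d) : ℝ := score pm θ x i * score pm θ x j

/-- `f(θ; x, v) = vᵀ ∇ₓ s_m(x; θ) v + ½ (vᵀ s_m(x; θ))²`. -/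
def slicedLoss (θ : E d) (x v : E D) : ℝ :=
  (∑ i, ∑ j, v i * scoreJacobian pm θ x i j * v j) + 1 / 2 * (∑ i, v i * score pm θ x i) ^ 2

/-- The population sliced objective
`J(θ; p_v) = 𝔼_{p_v} 𝔼_{p_d} [vᵀ ∇ₓ s_m(x; θ) v + ½ (vᵀ s_m(x; θ))²]`. -/
def slicedObjective (pd : E D → ℝ) (pv : Measure (E D)) (θ : E d) : ℝ :=
  ∫ v, ∫ x, slicedLoss pm θ x v ∂(densityMeasure pd) ∂pv

/-- The population (non-sliced) score matching objective
`J(θ) = 𝔼_{p_d} [tr (∇ₓ s_m(x; θ)) + ½ ‖s_m(x; θ)‖²]`. -/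
def scoreMatchingObjective (pd : E D → ℝ) (θ : E d) : ℝ :=
  ∫ x, ((scoreJacobian pm θ x).trace + 1 / 2 * ‖score pm θ x‖ ^ 2) ∂(densityMeasure pd)

/-- The empirical sliced objective `Ĵ(θ; x₁ᴺ, v₁₁ᴺᴹ)`, for the first `N` terms of a sequence of
data points with `M` projection vectors each. -/
def empiricalObjective (N M : ℕ) (x : ℕ → E D) (v : ℕ → Fin M → E D) (θ : E d) : ℝ :=
  1 / (N : ℝ) * (1 / (M : ℝ)) * ∑ i ∈ Finset.range N, ∑ j, slicedLoss pm θ (x i) (v i j)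

/-- `∇_θ ∂ᵢ ∂ⱼ l_m + ½ ∇_θ (∂ᵢ l_m ∂ⱼ l_m)`, at the point `x` and the parameter `θ`. -/
def gradTerm (θ : E d) (i j : Fin D) (x : E D) : E d :=
  gradient (secondPartial pm x i j) θ + (1 / 2 : ℝ) • gradient (partialProd pm x i j) θ

/-- The `d × d` matrix `𝔙_{ijpq}`, at the parameter `θ`. -/
def frakV (pd : E D → ℝ) (θ : E d) (i j p q : Fin D) : Matrix (Fin d) (Fin d) ℝ :=
  Matrix.of fun a b =>
    ∫ x, gradTerm pm θ i j x a * gradTerm pm θ p q x b ∂(densityMeasure pd)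

/-- `V_{ij} = 𝔙_{iijj}`. -/
def matV (pd : E D → ℝ) (θ : E d) (i j : Fin D) : Matrix (Fin d) (Fin d) ℝ :=
  frakV pm pd θ i i j j

/-- `W_{ij} = 𝔙_{ijij}`. -/
def matW (pd : E D → ℝ) (θ : E d) (i j : Fin D) : Matrix (Fin d) (Fin d) ℝ :=
  frakV pm pd θ i j i j

end Model

section Projections

variable {D : ℕ}

/-- The second moment matrix `Σ = 𝔼_{p_v}[v vᵀ]`. -/
def secondMoment (pv : Measure (E D)) : Matrix (Fin D) (Fin D) ℝ :=
  Matrix.of fun i j => ∫ v, v i * v j ∂pv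

/-- The fourth moments `𝔖_{ijpq} = 𝔼_{p_v}[vᵢ vⱼ v_p v_q]`. -/
def fourthMoment (pv : Measure (E D)) (i j p q : Fin D) : ℝ :=
  ∫ v, v i * v j * v p * v q ∂pv

/-- The multivariate Rademacher distribution: the uniform distribution on `{±1}ᴰ`. -/
def rademacher (D : ℕ) : Measure (E D) := uniformOn {v : E D | ∀ i, v i = 1 ∨ v i = -1}

end Projections

/-- The middle matrix
`∑_{ijpq} [(1 - 1/M) Σ_{ij} Σ_{pq} + (1/M) 𝔖_{ijpq}] 𝔙_{ijpq}` of the asymptotic covariance. -/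
def middleMatrix {d D : ℕ} (pm : E d → E D → ℝ) (pd : E D → ℝ) (pv : Measure (E D)) (M : ℕ)
    (θ : E d) : Matrix (Fin d) (Fin d) ℝ :=
  ∑ i, ∑ j, ∑ p, ∑ q,
    ((1 - 1 / (M : ℝ)) * (secondMoment pv i j * secondMoment pv p q)
      + 1 / (M : ℝ) * fourthMoment pv i j p q) • frakV pm pd θ i j p q

section Probability

variable {Ω : Type*} [MeasurableSpace Ω]

/-- The data points `xᵢ` are i.i.d. with density `pd`, the projection vectors `v_{ij}` are
i.i.d. with law `pv`, and data and projections are independent: the tuples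
`(xᵢ, v_{i1}, …, v_{iM})` are independent, each with law `p_d ⊗ p_v^{⊗ M}`. -/
structure IsSlicedSample {D M : ℕ} (P : Measure Ω) (pd : E D → ℝ) (pv : Measure (E D))
    [SigmaFinite pv] (x : ℕ → Ω → E D) (v : ℕ → Fin M → Ω → E D) : Prop where
  indep : iIndepFun (fun i ω => (x i ω, fun j => v i j ω)) P
  law : ∀ i, HasLaw (fun ω => (x i ω, fun j => v i j ω))
    ((densityMeasure pd).prod (Measure.pi fun _ : Fin M => pv)) P

/-- `θ̂_N` is a (measurable) minimizer over `Θ` of the empirical objective on the first `N` data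
points with their `M` projections each, for every `N ≥ 1`. -/
structure IsSSMEstimator {d D M : ℕ} (P : Measure Ω) (pm : E d → E D → ℝ) (Θ : Set (E d))
    (x : ℕ → Ω → E D) (v : ℕ → Fin M → Ω → E D) (θhat : ℕ → Ω → E d) : Prop where
  aemeasurable : ∀ N, AEMeasurable (θhat N) P
  mem : ∀ N, 0 < N → ∀ᵐ ω ∂P, θhat N ω ∈ Θ
  isMinOn : ∀ N, 0 < N → ∀ᵐ ω ∂P,
    IsMinOn (empiricalObjective pm N M (fun i => x i ω) (fun i j => v i j ω)) Θ (θhat N ω)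

/-- `X_N` converges in distribution to `𝒩(0, S)`, where `S` is a genuine (positive semidefinite)
covariance matrix. -/
def TendstoToNormal {d : ℕ} (P : Measure Ω) [IsProbabilityMeasure P] (X : ℕ → Ω → E d)
    (S : Matrix (Fin d) (Fin d) ℝ) : Prop :=
  S.PosSemidef ∧ TendstoInDistribution X atTop id (fun _ => P) (multivariateGaussian 0 S)

end Probability

end

end SlicedScoreMatching

open SlicedScoreMatching

/-! The key is to treat each data point together with its `M` projections as one observation `z =
(x, w)` with law `p_d ⊗ p_v^{⊗M}` and loss `sampleLoss`. These observations are i.i.d. and only `N`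
grows, so the estimator is an ordinary M-estimator.

Identification (`density_eq_of_slicedObjective_le`): integration by parts along `v` turns the excess
risk into `½ 𝔼⟨u(x), v⟩²`, where `u` is the difference of the two scores. Averaging over `v` gives
`½ 𝔼[uᵀ Σ u]` with `Σ` positive definite. Without excess risk, `u` vanishes almost everywhere, hence
everywhere by continuity; normalized positive densities with equal scores are equal. So `θ*` is the
unique population minimizer over `Θ`.

M-estimation (`tendstoToNormal_argmin`): the law of large numbers on a countable dense set, a
Lipschitz bound and compactness give strong consistency. Eventually the minimizer lies in a ball
inside `Θ`, so the empirical gradient vanishes there. Taylor expansion gives `θ̂ - θ* = -H⁻¹ (mean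
gradient at θ*)` up to an error `ε_N ‖θ̂ - θ*‖` with `ε_N → 0` almost surely. Such a relative error
is absorbed by `tendstoInDistribution_of_norm_sub_le`, and the central limit theorem handles the
leading term.

Covariance (`momentMatrix_gradient_sampleLoss`): the loss is linear in `v vᵀ`, so its gradient is a
sum of products of a function of `x` and the averaged outer product of the projections. Second
moments factor by independence; among the `M²` pairs of projections, `M` coincide and yield fourth
moments, while the others yield products of second moments.

Special laws (`fourthMoment_eq`, `middleMatrix_eq`): invariance under sign changes of coordinates
leaves only paired moments, that is, Isserlis' formula plus a diagonal correction `κ`, with `κ = 0`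
for Gaussian and `κ = -2` for Rademacher projections. -/

namespace SlicedScoreMatching

noncomputable section

/-! ### Limit theorems for i.i.d. samples and consistency of minimizers -/

section Limits

variable {Ω : Type*} [MeasurableSpace Ω] {P : Measure Ω}

/-- The second moment matrix of a random vector. -/
def momentMatrix {Z : Type*} [MeasurableSpace Z] {d : ℕ} (μ : Measure Z) (g : Z → E d) :
    Matrix (Fin d) (Fin d) ℝ :=
  Matrix.of fun a b => ∫ z, g z a * g z b ∂μ

lemma integrable_coord_mul_coord {Z : Type*} [MeasurableSpace Z] {d : ℕ} {μ : Measure Z}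
    {g : Z → E d} (hg : MemLp g 2 μ) (a b : Fin d) : Integrable (fun z => g z a * g z b) μ := by
  have h : ∀ a, MemLp (fun z => g z a) 2 μ := fun a =>
    (EuclideanSpace.proj (𝕜 := ℝ) a).comp_memLp' hg
  exact (h a).integrable_mul (h b)

/-- Serves twice: as the variance of a one-dimensional projection in the central limit theorem, and,
with `g` the identity, to average `⟨u, v⟩²` over the projection vectors. -/
lemma integral_inner_sq {Z : Type*} [MeasurableSpace Z] {d : ℕ} {μ : Measure Z}
    {g : Z → E d} (hg : MemLp g 2 μ) (t : E d) :
    ∫ z, (inner ℝ (g z) t) ^ 2 ∂μ = t.ofLp ⬝ᵥ (momentMatrix μ g).mulVec t.ofLp := by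
  have h1 : ∀ z, (inner ℝ (g z) t) ^ 2 = ∑ a, ∑ b, t a * (g z a * g z b) * t b := by
    intro z
    rw [PiLp.inner_apply, sq, Finset.sum_mul_sum]
    refine Finset.sum_congr rfl fun a _ => Finset.sum_congr rfl fun b _ => ?_
    simp only [RCLike.inner_apply, conj_trivial]
    ring
  simp_rw [h1]
  rw [integral_finsetSum _ fun a _ => integrable_finsetSum _ fun b _ =>
    ((integrable_coord_mul_coord hg a b).const_mul _).mul_const _]
  simp only [dotProduct, Matrix.mulVec, Finset.mul_sum]
  refine Finset.sum_congr rfl fun a _ => ?_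
  rw [integral_finsetSum _ fun b _ =>
    ((integrable_coord_mul_coord hg a b).const_mul _).mul_const _]
  refine Finset.sum_congr rfl fun b _ => ?_
  rw [integral_mul_const, integral_const_mul]
  simp [momentMatrix, mul_assoc]

lemma momentMatrix_posSemidef {Z : Type*} [MeasurableSpace Z] {d : ℕ} {μ : Measure Z}
    {g : Z → E d} (hg : MemLp g 2 μ) : (momentMatrix μ g).PosSemidef := by
  refine Matrix.PosSemidef.of_dotProduct_mulVec_nonneg ?_ fun x => ?_
  · ext a b
    simp [momentMatrix, mul_comm]
  · have := integral_inner_sq hg (WithLp.toLp 2 x)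
    simp only [star_trivial]
    rw [← this]
    positivity

/-- Multivariate central limit theorem for centred square integrable i.i.d. vectors. -/
theorem tendstoToNormal_clt [IsProbabilityMeasure P] {Z : Type*} [MeasurableSpace Z] {d : ℕ}
    {μ : Measure Z}
    {g : Z → E d} (hg : MemLp g 2 μ) (h0 : ∫ z, g z ∂μ = 0)
    {z : ℕ → Ω → Z} (hind : iIndepFun z P) (hlaw : ∀ i, HasLaw (z i) μ P) :
    TendstoToNormal P (fun N ω => (√(N : ℝ))⁻¹ • ∑ i ∈ Finset.range N, g (z i ω))
      (momentMatrix μ g) := by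
  have hS := momentMatrix_posSemidef hg
  have hzm : ∀ i, AEMeasurable (z i) P := fun i => (hlaw i).aemeasurable
  have hgm : AEMeasurable g μ := hg.aestronglyMeasurable.aemeasurable
  have hgP : ∀ i, AEMeasurable g (P.map (z i)) := fun i => by rwa [(hlaw i).map_eq]
  have hμ : IsProbabilityMeasure μ := (hlaw 0).isProbabilityMeasure_iff.1 inferInstance
  have hmeas : ∀ N : ℕ, AEMeasurable
      (fun ω => (√(N : ℝ))⁻¹ • ∑ i ∈ Finset.range N, g (z i ω)) P := by
    intro N
    have := Finset.aemeasurable_fun_sum (μ := P) (f := fun i ω => g (z i ω)) (Finset.range N)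
      fun i _ => (hgP i).comp_aemeasurable (hzm i)
    exact this.const_smul (√(N : ℝ))⁻¹
  refine ⟨hS, hmeas, aemeasurable_id, ?_⟩
  refine ProbabilityMeasure.tendsto_iff_tendsto_charFun.2 fun t => ?_
  simp only [ProbabilityMeasure.coe_mk, Measure.map_id]
  rw [charFun_multivariateGaussian hS]
  -- one dimensional projections
  let X : ℕ → Ω → ℝ := fun i ω => inner ℝ (g (z i ω)) t
  have hXg : AEMeasurable (fun y : Z => inner ℝ (g y) t) μ := hgm.inner_const
  have hXP : ∀ i, AEMeasurable (fun y : Z => inner ℝ (g y) t) (P.map (z i)) :=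
    fun i => (hgP i).inner_const
  have hXind : iIndepFun X P := hind.comp₀ (fun _ y => inner ℝ (g y) t) hzm hXP
  have hid : ∀ i, IdentDistrib (z i) (z 0) P P := fun i =>
    ⟨hzm i, hzm 0, by rw [(hlaw i).map_eq, (hlaw 0).map_eq]⟩
  have hXid : ∀ i, IdentDistrib (X i) (X 0) P P := fun i => (hid i).comp_of_aemeasurable (hXP i)
  have hgL : MemLp (fun y : Z => inner ℝ (g y) t) 2 μ := hg.inner_const t
  have hX2 : MemLp (X 0) 2 P := by
    have := hgL
    rw [← (hlaw 0).map_eq] at this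
    exact this.comp_of_map (hzm 0)
  have hX0 : P[X 0] = 0 := by
    have h : ∫ ω, X 0 ω ∂P = ∫ y, inner ℝ (g y) t ∂μ := by
      rw [← (hlaw 0).map_eq, integral_map (hzm 0) (hXP 0).aestronglyMeasurable]
    rw [h]
    have h2 := integral_inner (𝕜 := ℝ) (hg.integrable (by norm_num)) t
    simp_rw [real_inner_comm t] at h2 ⊢
    rw [h0] at h2
    simpa [real_inner_comm] using h2
  have hvar : Var[X 0; P] = t.ofLp ⬝ᵥ (momentMatrix μ g).mulVec t.ofLp := by
    rw [variance_of_integral_eq_zero (hXid 0).aemeasurable_fst hX0, ← integral_inner_sq hg,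
      ← (hlaw 0).map_eq, integral_map (hzm 0) ((hXP 0).pow_const 2).aestronglyMeasurable]
  have hclt := tendstoInDistribution_inv_sqrt_mul_sum_sub (P := P) (X := X)
    (P' := gaussianReal 0 Var[X 0; P].toNNReal) (Y := id) ⟨aemeasurable_id, Measure.map_id⟩
    hX2 hXind hXid
  -- Cramér–Wold: the characteristic function of the vector at `t` is that of its scalar projection
  -- `⟨·, t⟩` at `1`.
  have h1 := ProbabilityMeasure.tendsto_iff_tendsto_charFun.1 hclt.tendsto 1
  simp only [ProbabilityMeasure.coe_mk, Measure.map_id, charFun_gaussianReal] at h1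
  convert! h1 using 2 with N
  · rw [charFun_apply, charFun_apply, integral_map (hmeas N) (by fun_prop),
      integral_map (hclt.forall_aemeasurable N) (by fun_prop)]
    refine integral_congr_ae (Eventually.of_forall fun ω => ?_)
    simp [X, hX0, inner_smul_left, sum_inner, RCLike.inner_apply]
  · rw [hvar, Real.coe_toNNReal _ (by simpa using hS.dotProduct_mulVec_nonneg t.ofLp)]
    simp

/-- If `U - ℓ` is eventually almost surely negligible compared to `U` and `ℓ` converges in
distribution, then `U` converges to the same limit. -/
theorem tendstoInDistribution_of_norm_sub_le [IsProbabilityMeasure P] {F Ω' : Type*}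
    [NormedAddCommGroup F] [NormedSpace ℝ F]
    [SecondCountableTopology F] [MeasurableSpace F] [BorelSpace F]
    [MeasurableSpace Ω'] {P' : Measure Ω'} [IsProbabilityMeasure P']
    {ℓ U : ℕ → Ω → F} {Z : Ω' → F} {ε : ℕ → Ω → ℝ}
    (hℓ : TendstoInDistribution ℓ atTop Z (fun _ => P) P')
    (hU : ∀ N, AEMeasurable (U N) P)
    (hε : ∀ᵐ ω ∂P, Tendsto (fun N => ε N ω) atTop (𝓝 0))
    (h : ∀ᵐ ω ∂P, ∀ᶠ N in atTop, ‖U N ω - ℓ N ω‖ ≤ ε N ω * ‖U N ω‖) :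
    TendstoInDistribution U atTop Z (fun _ => P) P' := by
  -- Dividing by `1 + ‖ℓ‖` makes the discrepancy tend to zero almost surely without any tightness
  -- argument. Then `U` is the continuous function `(a, b) ↦ a + (1 + ‖a‖) b` of `(ℓ, η)`, and
  -- Slutsky's theorem applies.
  let η : ℕ → Ω → F := fun N ω => (1 + ‖ℓ N ω‖)⁻¹ • (U N ω - ℓ N ω)
  have hℓm := hℓ.forall_aemeasurable
  have hη : ∀ N, AEMeasurable (η N) P := fun N =>
    ((hℓm N).norm.const_add 1).inv.smul ((hU N).sub (hℓm N))
  have hη0 : ∀ᵐ ω ∂P, Tendsto (fun N => η N ω) atTop (𝓝 0) := by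
    filter_upwards [hε, h] with ω h1 h2
    have h1' : Tendsto (fun N => |ε N ω|) atTop (𝓝 0) := by simpa using h1.abs
    have h3 : Tendsto (fun N => 2 * |ε N ω|) atTop (𝓝 0) := by simpa using h1'.const_mul 2
    refine squeeze_zero_norm' ?_ h3
    filter_upwards [h2, h1'.eventually_le_const (show (0 : ℝ) < 1 / 2 by norm_num)] with N hN hN2
    have hpos : 0 < 1 + ‖ℓ N ω‖ := by positivity
    have hUl : ‖U N ω‖ ≤ ‖U N ω - ℓ N ω‖ + ‖ℓ N ω‖ := by
      simpa using norm_add_le (U N ω - ℓ N ω) (ℓ N ω)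
    have hU0 := norm_nonneg (U N ω)
    have hε0 := abs_nonneg (ε N ω)
    have hN3 : ‖U N ω - ℓ N ω‖ ≤ |ε N ω| * ‖U N ω‖ :=
      hN.trans (mul_le_mul_of_nonneg_right (le_abs_self _) hU0)
    -- Once `|ε| ≤ 1/2`, half of `‖U‖` can be absorbed on the left.
    have hU2 : ‖U N ω‖ ≤ 2 * ‖ℓ N ω‖ := by nlinarith
    rw [norm_smul, norm_inv, Real.norm_of_nonneg hpos.le, inv_mul_le_iff₀ hpos]
    nlinarith
  have := hℓ.continuous_comp_prodMk_of_tendstoInMeasure_const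
    (g := fun x : F × F => x.1 + (1 + ‖x.1‖) • x.2) (by fun_prop)
    (tendstoInMeasure_of_tendsto_ae (fun N => (hη N).aestronglyMeasurable) hη0) hη
  convert! this using 2 with N
  · ext ω
    have hpos : (1 + ‖ℓ N ω‖) ≠ 0 := by positivity
    simp [η, smul_smul, hpos]
  · simp

/-- Strong law of large numbers for functions of an i.i.d. sample. -/
lemma ae_tendsto_average {Z F : Type*} [MeasurableSpace Z] {μ : Measure Z}
    [NormedAddCommGroup F] [NormedSpace ℝ F] [CompleteSpace F] [MeasurableSpace F] [BorelSpace F]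
    [SecondCountableTopology F] {h : Z → F} (hh : Integrable h μ)
    {z : ℕ → Ω → Z} (hind : iIndepFun z P) (hlaw : ∀ i, HasLaw (z i) μ P) :
    ∀ᵐ ω ∂P, Tendsto (fun N : ℕ => (N : ℝ)⁻¹ • ∑ i ∈ Finset.range N, h (z i ω)) atTop
      (𝓝 (∫ y, h y ∂μ)) := by
  have hzm : ∀ i, AEMeasurable (z i) P := fun i => (hlaw i).aemeasurable
  have hP : ∀ i, AEMeasurable h (P.map (z i)) := fun i => by
    rw [(hlaw i).map_eq]; exact hh.aestronglyMeasurable.aemeasurable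
  have hid : ∀ i, IdentDistrib (z i) (z 0) P P := fun i =>
    ⟨hzm i, hzm 0, by rw [(hlaw i).map_eq, (hlaw 0).map_eq]⟩
  have hint : Integrable (fun ω => h (z 0 ω)) P := by
    have := hh
    rw [← (hlaw 0).map_eq] at this
    exact this.comp_aemeasurable (hzm 0)
  have := strong_law_ae (μ := P) (fun i ω => h (z i ω)) hint
    (fun i j hij => (hind.comp₀ (fun _ => h) hzm hP).indepFun hij)
    (fun i => (hid i).comp_of_aemeasurable (hP i))
  have he : ∫ ω, h (z 0 ω) ∂P = ∫ y, h y ∂μ := by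
    rw [← (hlaw 0).map_eq, integral_map (hzm 0) (hP 0).aestronglyMeasurable]
  rwa [he] at this

/-- Approximate minimizers of equi-Lipschitz functions converging on a dense subset of a compact
set converge to the unique minimizer of the limit. -/
lemma tendsto_argmin_of_dense {X : Type*} [PseudoMetricSpace X] {Θ Q : Set X} (hΘ : IsCompact Θ)
    (hQΘ : Q ⊆ Θ) (hQ : Θ ⊆ closure Q) {F : X → ℝ} {Fn : ℕ → X → ℝ} {θ₀ : X} {C : ℝ}
    (hC : 0 < C) (hF : ∀ a ∈ Θ, ∀ b ∈ Θ, |F a - F b| ≤ C * dist a b)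
    (hFn : ∀ᶠ n in atTop, ∀ a ∈ Θ, ∀ b ∈ Θ, |Fn n a - Fn n b| ≤ C * dist a b)
    (hlim : ∀ q ∈ Q, Tendsto (fun n => Fn n q) atTop (𝓝 (F q)))
    (hlim₀ : Tendsto (fun n => Fn n θ₀) atTop (𝓝 (F θ₀)))
    (hmin : ∀ θ ∈ Θ, θ ≠ θ₀ → F θ₀ < F θ) {t : ℕ → X} (ht : ∀ᶠ n in atTop, t n ∈ Θ)
    (htmin : ∀ᶠ n in atTop, Fn n (t n) ≤ Fn n θ₀) : Tendsto t atTop (𝓝 θ₀) := by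
  refine hΘ.tendsto_nhds_of_unique_mapClusterPt ht fun y hy hcl => ?_
  by_contra hne
  refine absurd (hmin y hy hne) (not_lt.2 (le_of_forall_pos_le_add fun ε hε => ?_))
  -- The budget is three times `ε / 3`: one for passing from `y` to `q` in `F`, two for passing from
  -- `q` through `y` to `t n` in `Fn n`, where the minimizing property takes over.
  obtain ⟨q, hq, hyq⟩ := Metric.mem_closure_iff.1 (hQ hy) (ε / (3 * C)) (by positivity)
  have hfreq : ∃ᶠ n in atTop, dist (t n) y < ε / (3 * C) :=
    hcl.frequently (Metric.ball_mem_nhds y (by positivity))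
  have hδ : C * (ε / (3 * C)) = ε / 3 := by field_simp
  have h1 : F q - F θ₀ ≤ 2 * (ε / 3) := by
    refine le_of_tendsto_of_frequently ((hlim q hq).sub hlim₀) ?_
    refine (hfreq.and_eventually (hFn.and (ht.and htmin))).mono fun n ⟨hn1, hn2, hn3, hn4⟩ => ?_
    have h2 := (abs_le.1 (hn2 q (hQΘ hq) (t n) hn3)).2
    have h3 : dist q (t n) ≤ ε / (3 * C) + ε / (3 * C) := by
      have := dist_triangle_right q (t n) y
      rw [dist_comm q y] at this
      linarith
    have h4 := mul_le_mul_of_nonneg_left h3 hC.le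
    linarith
  have h2 := (abs_le.1 (hF y hy q (hQΘ hq))).2
  have h3 := mul_le_mul_of_nonneg_left hyq.le hC.le
  linarith

/-- Strong consistency of minimizers of an empirical risk over a compact parameter set. -/
theorem ae_tendsto_argmin [IsProbabilityMeasure P] {Z X : Type*} [MeasurableSpace Z]
    {μ : Measure Z} [IsProbabilityMeasure μ]
    [MetricSpace X] {Θ : Set X} (hΘ : IsCompact Θ) {f : X → Z → ℝ} {L : Z → ℝ} {θ₀ : X}
    (hθ₀ : θ₀ ∈ Θ) (hf : ∀ θ ∈ Θ, Integrable (f θ) μ) (hL : Integrable L μ)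
    (hlip : ∀ y, ∀ a ∈ Θ, ∀ b ∈ Θ, |f a y - f b y| ≤ L y * dist a b)
    (hmin : ∀ θ ∈ Θ, θ ≠ θ₀ → ∫ y, f θ₀ y ∂μ < ∫ y, f θ y ∂μ)
    {z : ℕ → Ω → Z} (hind : iIndepFun z P) (hlaw : ∀ i, HasLaw (z i) μ P) {t : ℕ → Ω → X}
    (ht : ∀ N, 0 < N → ∀ᵐ ω ∂P, t N ω ∈ Θ)
    (htmin : ∀ N, 0 < N → ∀ᵐ ω ∂P,
      ∑ i ∈ Finset.range N, f (t N ω) (z i ω) ≤ ∑ i ∈ Finset.range N, f θ₀ (z i ω)) :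
    ∀ᵐ ω ∂P, Tendsto (fun N => t N ω) atTop (𝓝 θ₀) := by
  -- Countability of `Q` lets the law of large numbers hold at all its points on a single almost
  -- sure event.
  obtain ⟨Q, hQΘ, hQc, hQ⟩ := hΘ.isSeparable.exists_countable_dense_subset
  have hQae : ∀ᵐ ω ∂P, ∀ q ∈ Q, Tendsto
      (fun N : ℕ => (N : ℝ)⁻¹ • ∑ i ∈ Finset.range N, f q (z i ω)) atTop (𝓝 (∫ y, f q y ∂μ)) :=
    (ae_ball_iff hQc).2 fun q hq => ae_tendsto_average (hf q (hQΘ hq)) hind hlaw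
  have htae : ∀ᵐ ω ∂P, ∀ N, 0 < N → t N ω ∈ Θ ∧
      ∑ i ∈ Finset.range N, f (t N ω) (z i ω) ≤ ∑ i ∈ Finset.range N, f θ₀ (z i ω) := by
    refine ae_all_iff.2 fun N => ?_
    by_cases hN : 0 < N
    · filter_upwards [ht N hN, htmin N hN] with ω h1 h2 _ using ⟨h1, h2⟩
    · exact Eventually.of_forall fun ω h => absurd h hN
  filter_upwards [hQae, htae, ae_tendsto_average (hf θ₀ hθ₀) hind hlaw,
    ae_tendsto_average hL hind hlaw] with ω h1 h2 h3 h4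
  -- The averages of `L` converge to `∫ L`, so they are eventually below `|∫ L| + 1`, which is also
  -- positive and a Lipschitz constant of the limit.
  refine tendsto_argmin_of_dense hΘ hQΘ hQ (F := fun θ => ∫ y, f θ y ∂μ)
    (C := |∫ y, L y ∂μ| + 1) (by positivity) ?_ ?_ h1 h3 hmin
    ((eventually_gt_atTop 0).mono fun N hN => (h2 N hN).1)
    ((eventually_gt_atTop 0).mono fun N hN => ?_)
  · intro a ha b hb
    rw [← integral_sub (hf a ha) (hf b hb)]
    calc |∫ y, f a y - f b y ∂μ| ≤ ∫ y, L y * dist a b ∂μ :=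
          (Real.norm_eq_abs _).symm.trans_le <| norm_integral_le_of_norm_le (hL.mul_const _)
            (Eventually.of_forall fun y => hlip y a ha b hb)
      _ = (∫ y, L y ∂μ) * dist a b := integral_mul_const _ _
      _ ≤ _ := mul_le_mul_of_nonneg_right ((le_abs_self _).trans (by linarith)) dist_nonneg
  · filter_upwards [h4.eventually_le_const (show _ < |∫ y, L y ∂μ| + 1 from
      (le_abs_self _).trans_lt (lt_add_one _))] with N hN a ha b hb
    simp only [smul_eq_mul] at hN ⊢
    rw [← mul_sub, ← Finset.sum_sub_distrib, abs_mul, abs_of_nonneg (by positivity)]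
    calc (N : ℝ)⁻¹ * |∑ i ∈ Finset.range N, (f a (z i ω) - f b (z i ω))|
        ≤ (N : ℝ)⁻¹ * ∑ i ∈ Finset.range N, L (z i ω) * dist a b := by
          gcongr
          exact (Finset.abs_sum_le_sum_abs _ _).trans
            (Finset.sum_le_sum fun i _ => hlip _ a ha b hb)
      _ = ((N : ℝ)⁻¹ * ∑ i ∈ Finset.range N, L (z i ω)) * dist a b := by
          rw [← Finset.sum_mul, mul_assoc]
      _ ≤ _ := mul_le_mul_of_nonneg_right hN dist_nonneg
  · exact mul_le_mul_of_nonneg_left (h2 N hN).2 (by positivity)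

end Limits

/-! ### Hessian matrices and iterated Fréchet derivatives -/

section Hessian

variable {n : ℕ}

/-- The `i`-th standard basis vector of `ℝⁿ`. -/
abbrev basisVec (i : Fin n) : E n := EuclideanSpace.single i 1

lemma eq_sum_smul_basisVec (u : E n) : u = ∑ i, u i • basisVec i := by
  ext j
  simp [Finset.sum_apply, Pi.single_apply]

/-- The vector representing a linear form. -/
def dualToVec : (E n →L[ℝ] ℝ) →L[ℝ] E n :=
  ∑ j, (ContinuousLinearMap.apply ℝ ℝ (basisVec j)).smulRight (basisVec j)

@[simp]
lemma dualToVec_apply (T : E n →L[ℝ] ℝ) (j : Fin n) : dualToVec T j = T (basisVec j) := by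
  simp [dualToVec, Pi.single_apply]

lemma gradient_apply (h : E n → ℝ) (x : E n) (j : Fin n) :
    gradient h x j = fderiv ℝ h x (basisVec j) := by
  have : inner ℝ (gradient h x) (basisVec j) = fderiv ℝ h x (basisVec j) :=
    InnerProductSpace.toDual_symm_apply
  rw [← this, PiLp.inner_apply]
  simp

lemma gradient_eq_dualToVec (h : E n → ℝ) : gradient h = fun x => dualToVec (fderiv ℝ h x) := by
  funext x
  ext j
  rw [gradient_apply, dualToVec_apply]

lemma hess_apply {h : E n → ℝ} {x : E n} (hd : DifferentiableAt ℝ (fderiv ℝ h) x) (i j : Fin n) :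
    hess h x i j = fderiv ℝ (fderiv ℝ h) x (basisVec i) (basisVec j) := by
  have h1 := (dualToVec (n := n)).hasFDerivAt.comp x hd.hasFDerivAt
  have h2 : fderiv ℝ (gradient h) x = dualToVec.comp (fderiv ℝ (fderiv ℝ h) x) := by
    rw [gradient_eq_dualToVec]
    exact h1.fderiv
  simp [hess, h2]

/-- The Hessian depends only on the germ of the function. This allows exchanging objectives that are
known to agree only on `Θ`, a neighbourhood of the true parameter. -/
lemma hess_congr {h k : E n → ℝ} {x : E n} (e : h =ᶠ[𝓝 x] k) : hess h x = hess k x := by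
  have h1 : gradient h =ᶠ[𝓝 x] gradient k := by
    filter_upwards [e.fderiv (𝕜 := ℝ)] with y hy
    rw [gradient, gradient, hy]
  rw [hess, hess, h1.fderiv_eq]

lemma frobeniusNorm_nonneg {m : ℕ} (A : Matrix (Fin m) (Fin n) ℝ) : 0 ≤ frobeniusNorm A := by
  rw [frobeniusNorm, Matrix.frobenius_norm_def]
  positivity

lemma frobeniusNorm_sq {m : ℕ} (A : Matrix (Fin m) (Fin n) ℝ) :
    frobeniusNorm A ^ 2 = ∑ i, ∑ j, A i j ^ 2 := by
  rw [frobeniusNorm, Matrix.frobenius_norm_def, ← Real.sqrt_eq_rpow, Real.sq_sqrt (by positivity)]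
  simp

lemma abs_apply_le_frobeniusNorm {m : ℕ} (A : Matrix (Fin m) (Fin n) ℝ) (i : Fin m) (j : Fin n) :
    |A i j| ≤ frobeniusNorm A := by
  refine abs_le_of_sq_le_sq ?_ (frobeniusNorm_nonneg A)
  rw [frobeniusNorm_sq]
  exact (Finset.single_le_sum (f := fun j => A i j ^ 2) (fun _ _ => sq_nonneg _)
    (Finset.mem_univ j)).trans (Finset.single_le_sum (f := fun i => ∑ j, A i j ^ 2)
      (fun _ _ => Finset.sum_nonneg fun _ _ => sq_nonneg _) (Finset.mem_univ i))

lemma norm_le_of_apply_basisVec {F : Type*} [NormedAddCommGroup F] [NormedSpace ℝ F]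
    (T : E n →L[ℝ] F) {c : ℝ} (hT : ∀ i, ‖T (basisVec i)‖ ≤ c) (hc : 0 ≤ c) : ‖T‖ ≤ n * c := by
  refine T.opNorm_le_bound (by positivity) fun u => ?_
  calc ‖T u‖ = ‖∑ i, u i • T (basisVec i)‖ := by
        conv_lhs => rw [eq_sum_smul_basisVec u]
        simp [map_sum]
    _ ≤ ∑ i : Fin n, ‖u‖ * c := by
        refine norm_sum_le_of_le _ fun i _ => ?_
        rw [norm_smul]
        exact mul_le_mul (PiLp.norm_apply_le u i) (hT i) (norm_nonneg _) (norm_nonneg _)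
    _ = n * c * ‖u‖ := by simp; ring

end Hessian

/-! ### Losses with Lipschitz second derivative, and differentiation under the integral -/

section Derivatives

set_option maxSynthPendingDepth 3

variable {Z : Type*} [MeasurableSpace Z] {μ : Measure Z} {d : ℕ}

/-- A derivative with respect to a parameter is measurable. -/
lemma aestronglyMeasurable_of_hasFDerivAt {F : Type*} [NormedAddCommGroup F] [NormedSpace ℝ F]
    {g : E d → Z → F} {g' : Z → E d →L[ℝ] F} {θ₀ : E d}
    (hg : ∀ᶠ θ in 𝓝 θ₀, AEStronglyMeasurable (g θ) μ)
    (hd : ∀ z, HasFDerivAt (fun θ => g θ z) (g' z) θ₀) : AEStronglyMeasurable g' μ := by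
  have h1 : ∀ u : E d, AEStronglyMeasurable (fun z => g' z u) μ := by
    intro u
    -- The directional derivative is the limit of the difference quotients with step `1/k`. The
    -- shift by `k₀` keeps all evaluation points in the neighbourhood where `g θ` is measurable.
    have ht : Tendsto (fun k : ℕ => θ₀ + (k : ℝ)⁻¹ • u) atTop (𝓝 θ₀) := by
      simpa using ((tendsto_inv_atTop_nhds_zero_nat (𝕜 := ℝ)).smul_const u).const_add θ₀
    obtain ⟨k₀, hk₀⟩ := eventually_atTop.1 (ht.eventually hg)
    refine aestronglyMeasurable_of_tendsto_ae (u := atTop)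
      (f := fun k : ℕ => fun z => ((k + k₀ : ℕ) : ℝ) •
        (g (θ₀ + ((k + k₀ : ℕ) : ℝ)⁻¹ • u) z - g θ₀ z)) (fun k => ?_)
      (Eventually.of_forall fun z => ?_)
    · exact ((hk₀ _ (by simp)).sub hg.self_of_nhds).const_smul _
    · exact ((hd z).lim_real u).comp
        (tendsto_natCast_atTop_atTop.comp (tendsto_add_atTop_nat k₀))
  have h2 : g' = fun z => ∑ i, (EuclideanSpace.proj (𝕜 := ℝ) i).smulRight (g' z (basisVec i)) := by
    funext z
    ext u
    conv_lhs => rw [eq_sum_smul_basisVec u]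
    simp [map_sum]
  rw [h2]
  refine Finset.aestronglyMeasurable_fun_sum _ fun i _ => ?_
  exact (ContinuousLinearMap.smulRightL ℝ (E d) F
    (EuclideanSpace.proj (𝕜 := ℝ) i)).continuous.comp_aestronglyMeasurable (h1 _)

/-- A family of loss functions that is Lipschitz with square integrable constant and twice
continuously differentiable near `θ₀`, with second derivative Lipschitz with integrable constant. -/
structure IsRegularLoss (μ : Measure Z) (f : E d → Z → ℝ) (θ₀ : E d) (r : ℝ) (L K : Z → ℝ) :
    Prop where
  pos : 0 < r
  integrable : ∀ θ ∈ Metric.ball θ₀ r, Integrable (f θ) μ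
  memLp : MemLp L 2 μ
  lip : ∀ z, ∀ a ∈ Metric.ball θ₀ r, ∀ b ∈ Metric.ball θ₀ r, |f a z - f b z| ≤ L z * ‖a - b‖
  contDiffOn : ∀ z, ContDiffOn ℝ 2 (fun θ => f θ z) (Metric.ball θ₀ r)
  integrable_const : Integrable K μ
  lip_fderiv_fderiv : ∀ z, ∀ θ ∈ Metric.ball θ₀ r,
    ‖fderiv ℝ (fderiv ℝ fun θ => f θ z) θ - fderiv ℝ (fderiv ℝ fun θ => f θ z) θ₀‖
      ≤ K z * ‖θ - θ₀‖

namespace IsRegularLoss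

variable {f : E d → Z → ℝ} {θ₀ : E d} {r : ℝ} {L K : Z → ℝ}

lemma mem (h : IsRegularLoss μ f θ₀ r L K) : θ₀ ∈ Metric.ball θ₀ r := Metric.mem_ball_self h.pos

lemma hasFDerivAt (h : IsRegularLoss μ f θ₀ r L K) (z : Z) {θ : E d} (hθ : θ ∈ Metric.ball θ₀ r) :
    HasFDerivAt (fun θ => f θ z) (fderiv ℝ (fun θ => f θ z) θ) θ :=
  (((h.contDiffOn z).contDiffAt (Metric.isOpen_ball.mem_nhds hθ)).differentiableAt
    (by norm_num)).hasFDerivAt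

lemma hasFDerivAt_fderiv (h : IsRegularLoss μ f θ₀ r L K) (z : Z) {θ : E d}
    (hθ : θ ∈ Metric.ball θ₀ r) :
    HasFDerivAt (fderiv ℝ fun θ => f θ z) (fderiv ℝ (fderiv ℝ fun θ => f θ z) θ) θ :=
  ((((h.contDiffOn z).contDiffAt (Metric.isOpen_ball.mem_nhds hθ)).fderiv_right
    (m := 1) (by norm_num)).differentiableAt (by norm_num)).hasFDerivAt

lemma norm_fderiv_le (h : IsRegularLoss μ f θ₀ r L K) (z : Z) {θ : E d}
    (hθ : θ ∈ Metric.ball θ₀ r) : ‖fderiv ℝ (fun θ => f θ z) θ‖ ≤ |L z| := by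
  refine (h.hasFDerivAt z hθ).le_of_lip' (abs_nonneg _) ?_
  filter_upwards [Metric.isOpen_ball.mem_nhds hθ] with a ha
  exact (h.lip z a ha θ hθ).trans (mul_le_mul_of_nonneg_right (le_abs_self _) (norm_nonneg _))

/-- The mean value inequality, applied to the first derivative on the closed ball of radius `‖θ -
θ₀‖`: there the second derivative differs from its value at `θ₀` by at most `|K| ‖θ - θ₀‖`. -/
lemma norm_taylor_le (h : IsRegularLoss μ f θ₀ r L K) (z : Z) {θ : E d}
    (hθ : θ ∈ Metric.ball θ₀ r) :
    ‖fderiv ℝ (fun θ => f θ z) θ - fderiv ℝ (fun θ => f θ z) θ₀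
      - fderiv ℝ (fderiv ℝ fun θ => f θ z) θ₀ (θ - θ₀)‖ ≤ |K z| * ‖θ - θ₀‖ * ‖θ - θ₀‖ := by
  have hsub : Metric.closedBall θ₀ ‖θ - θ₀‖ ⊆ Metric.ball θ₀ r := by
    refine Metric.closedBall_subset_ball ?_
    simpa [dist_eq_norm] using hθ
  refine (convex_closedBall θ₀ ‖θ - θ₀‖).norm_image_sub_le_of_norm_hasFDerivWithin_le'
    (fun y hy => (h.hasFDerivAt_fderiv z (hsub hy)).hasFDerivWithinAt) (fun y hy => ?_)
    (Metric.mem_closedBall_self (norm_nonneg _)) (by simp [dist_eq_norm])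
  refine (h.lip_fderiv_fderiv z y (hsub hy)).trans ?_
  rw [Metric.mem_closedBall, dist_eq_norm] at hy
  gcongr
  exact le_abs_self _

/-- The regularity assumptions do not bound the second derivative directly. The Taylor estimate
expresses it by two first derivatives, each at most `|L|`, and a remainder controlled by `K`;
testing increments with `r / 2 ≤ ‖u‖ < r` suffices by homogeneity. The resulting bound is
integrable. -/
lemma norm_fderiv_fderiv_le (h : IsRegularLoss μ f θ₀ r L K) (z : Z) :
    ‖fderiv ℝ (fderiv ℝ fun θ => f θ z) θ₀‖ ≤ (r / 2)⁻¹ * (2 * |L z|) + |K z| * r := by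
  have hr := h.pos
  refine ContinuousLinearMap.opNorm_le_of_shell (ε := r) (c := (2 : ℝ)) hr (by positivity)
    (by norm_num) fun u hu1 hu2 => ?_
  have hm : θ₀ + u ∈ Metric.ball θ₀ r := by simpa [dist_eq_norm] using hu2
  have h1 := h.norm_taylor_le z hm
  have h2 := h.norm_fderiv_le z hm
  have h3 := h.norm_fderiv_le z h.mem
  rw [add_sub_cancel_left] at h1
  have h4 : ‖fderiv ℝ (fderiv ℝ fun θ => f θ z) θ₀ u‖ ≤ 2 * |L z| + |K z| * ‖u‖ * ‖u‖ := by
    have h5 := norm_sub_norm_le (fderiv ℝ (fderiv ℝ fun θ => f θ z) θ₀ u)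
      (fderiv ℝ (fun θ => f θ z) (θ₀ + u) - fderiv ℝ (fun θ => f θ z) θ₀)
    have h6 := norm_sub_le (fderiv ℝ (fun θ => f θ z) (θ₀ + u)) (fderiv ℝ (fun θ => f θ z) θ₀)
    have h7 := norm_sub_rev (fderiv ℝ (fderiv ℝ fun θ => f θ z) θ₀ u)
      (fderiv ℝ (fun θ => f θ z) (θ₀ + u) - fderiv ℝ (fun θ => f θ z) θ₀)
    linarith
  refine h4.trans ?_
  rw [Real.norm_ofNat] at hu1
  have h7 : 1 ≤ (r / 2)⁻¹ * ‖u‖ := by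
    rw [inv_mul_eq_div, le_div_iff₀ (by positivity)]
    linarith
  have h8 := mul_le_mul_of_nonneg_left h7 (show 0 ≤ 2 * |L z| by positivity)
  have h9 : |K z| * ‖u‖ * ‖u‖ ≤ |K z| * r * ‖u‖ := by gcongr
  linarith

lemma aestronglyMeasurable_fderiv (h : IsRegularLoss μ f θ₀ r L K) {θ : E d}
    (hθ : θ ∈ Metric.ball θ₀ r) :
    AEStronglyMeasurable (fun z => fderiv ℝ (fun θ => f θ z) θ) μ := by
  refine aestronglyMeasurable_of_hasFDerivAt (g := f) ?_ fun z => h.hasFDerivAt z hθ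
  filter_upwards [Metric.isOpen_ball.mem_nhds hθ] with a ha
  exact (h.integrable a ha).aestronglyMeasurable

lemma aestronglyMeasurable_fderiv_fderiv (h : IsRegularLoss μ f θ₀ r L K) {θ : E d}
    (hθ : θ ∈ Metric.ball θ₀ r) :
    AEStronglyMeasurable (fun z => fderiv ℝ (fderiv ℝ fun θ => f θ z) θ) μ := by
  refine aestronglyMeasurable_of_hasFDerivAt (g := fun θ z => fderiv ℝ (fun θ => f θ z) θ) ?_
    fun z => h.hasFDerivAt_fderiv z hθ
  filter_upwards [Metric.isOpen_ball.mem_nhds hθ] with a ha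
  exact h.aestronglyMeasurable_fderiv ha

lemma memLp_fderiv (h : IsRegularLoss μ f θ₀ r L K) {θ : E d} (hθ : θ ∈ Metric.ball θ₀ r) :
    MemLp (fun z => fderiv ℝ (fun θ => f θ z) θ) 2 μ :=
  h.memLp.of_le (h.aestronglyMeasurable_fderiv hθ) (Eventually.of_forall fun z => by
    simpa using h.norm_fderiv_le z hθ)

variable [IsProbabilityMeasure μ]

lemma integrable_fderiv_fderiv (h : IsRegularLoss μ f θ₀ r L K) :
    Integrable (fun z => fderiv ℝ (fderiv ℝ fun θ => f θ z) θ₀) μ :=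
  ((((h.memLp.integrable (by norm_num)).abs.const_mul 2).const_mul (r / 2)⁻¹).add
    (h.integrable_const.abs.mul_const r)).mono'
      (h.aestronglyMeasurable_fderiv_fderiv h.mem)
      (Eventually.of_forall fun z => h.norm_fderiv_fderiv_le z)

lemma hasFDerivAt_integral (h : IsRegularLoss μ f θ₀ r L K) {θ : E d}
    (hθ : θ ∈ Metric.ball θ₀ r) :
    HasFDerivAt (fun θ => ∫ z, f θ z ∂μ) (∫ z, fderiv ℝ (fun θ => f θ z) θ ∂μ) θ := by
  have hn := Metric.isOpen_ball.mem_nhds hθ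
  refine hasFDerivAt_integral_of_dominated_of_fderiv_le (bound := fun z => |L z|)
    (F' := fun θ z => fderiv ℝ (fun θ => f θ z) θ) hn ?_
    (h.integrable θ hθ) (h.aestronglyMeasurable_fderiv hθ)
    (Eventually.of_forall fun z y hy => h.norm_fderiv_le z hy)
    (h.memLp.integrable (by norm_num)).abs
    (Eventually.of_forall fun z y hy => h.hasFDerivAt z hy)
  filter_upwards [hn] with a ha using (h.integrable a ha).aestronglyMeasurable

lemma hasFDerivAt_integral_fderiv (h : IsRegularLoss μ f θ₀ r L K) :
    HasFDerivAt (fun θ => ∫ z, fderiv ℝ (fun θ => f θ z) θ ∂μ)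
      (∫ z, fderiv ℝ (fderiv ℝ fun θ => f θ z) θ₀ ∂μ) θ₀ := by
  have hn := Metric.isOpen_ball.mem_nhds h.mem
  refine hasFDerivAt_integral_of_dominated_of_fderiv_le
    (bound := fun z => ‖fderiv ℝ (fderiv ℝ fun θ => f θ z) θ₀‖ + |K z| * r)
    (F' := fun θ z => fderiv ℝ (fderiv ℝ fun θ => f θ z) θ) hn ?_
    ((h.memLp_fderiv h.mem).integrable (by norm_num))
    (h.aestronglyMeasurable_fderiv_fderiv h.mem)
    (Eventually.of_forall fun z y hy => ?_)
    (h.integrable_fderiv_fderiv.norm.add (h.integrable_const.abs.mul_const r))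
    (Eventually.of_forall fun z y hy => h.hasFDerivAt_fderiv z hy)
  · filter_upwards [hn] with a ha using h.aestronglyMeasurable_fderiv ha
  · have h1 := h.lip_fderiv_fderiv z y hy
    rw [Metric.mem_ball, dist_eq_norm] at hy
    have h2 : K z * ‖y - θ₀‖ ≤ |K z| * r := by
      gcongr
      exact le_abs_self _
    have h3 := norm_le_norm_add_norm_sub' (fderiv ℝ (fderiv ℝ fun θ => f θ z) y)
      (fderiv ℝ (fderiv ℝ fun θ => f θ z) θ₀)
    linarith

lemma hess_integral (h : IsRegularLoss μ f θ₀ r L K) (i j : Fin d) :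
    hess (fun θ => ∫ z, f θ z ∂μ) θ₀ i j =
      (∫ z, fderiv ℝ (fderiv ℝ fun θ => f θ z) θ₀ ∂μ) (basisVec i) (basisVec j) := by
  have he : fderiv ℝ (fun θ => ∫ z, f θ z ∂μ) =ᶠ[𝓝 θ₀]
      fun θ => ∫ z, fderiv ℝ (fun θ => f θ z) θ ∂μ := by
    filter_upwards [Metric.isOpen_ball.mem_nhds h.mem] with θ hθ
    exact (h.hasFDerivAt_integral hθ).fderiv
  have hd := h.hasFDerivAt_integral_fderiv.congr_of_eventuallyEq he
  rw [hess_apply hd.differentiableAt, hd.fderiv]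

/-- This form is the second derivative of the population risk at `θ₀`, so symmetry of second
derivatives applies to it as a whole. -/
lemma integral_fderiv_fderiv_symm (h : IsRegularLoss μ f θ₀ r L K) (u w : E d) :
    (∫ z, fderiv ℝ (fderiv ℝ fun θ => f θ z) θ₀ ∂μ) u w =
      (∫ z, fderiv ℝ (fderiv ℝ fun θ => f θ z) θ₀ ∂μ) w u :=
  second_derivative_symmetric_of_eventually
    (by filter_upwards [Metric.isOpen_ball.mem_nhds h.mem] with θ hθ
        exact h.hasFDerivAt_integral hθ)
    h.hasFDerivAt_integral_fderiv u w

end IsRegularLoss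

end Derivatives

/-! ### Asymptotic normality of M-estimators -/

section MEstimation

set_option maxSynthPendingDepth 3

variable {Ω : Type*} [MeasurableSpace Ω] {P : Measure Ω} [IsProbabilityMeasure P]
  {Z : Type*} [MeasurableSpace Z] {μ : Measure Z} {d : ℕ}

/-- The Riesz vector of `T u` has entries `T u eⱼ`, whereas row `j` of `A` applied to `u` is `T eⱼ
u`; symmetry identifies the two, so `A⁻¹` undoes `T`. -/
lemma toEuclideanCLM_dualToVec {A : Matrix (Fin d) (Fin d) ℝ} (hA : IsUnit A.det)
    {T : E d →L[ℝ] E d →L[ℝ] ℝ} (hT : ∀ i j, T (basisVec i) (basisVec j) = A i j)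
    (hsymm : ∀ u w, T u w = T w u) (u : E d) :
    Matrix.toEuclideanCLM (𝕜 := ℝ) A⁻¹ (dualToVec (T u)) = u := by
  have h1 : dualToVec (T u) = Matrix.toEuclideanCLM (𝕜 := ℝ) A u := by
    ext j
    rw [dualToVec_apply, hsymm]
    conv_lhs => rw [eq_sum_smul_basisVec u]
    simp [map_sum, hsymm (basisVec j), hT, Matrix.mulVec, dotProduct, ← hT j, mul_comm]
  rw [h1, ← mul_apply_eq_comp, ← map_mul, Matrix.nonsing_inv_mul _ hA, map_one]
  rfl

lemma momentMatrix_toEuclideanCLM {B : Matrix (Fin d) (Fin d) ℝ} {g : Z → E d}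
    (hg : MemLp g 2 μ) :
    momentMatrix μ (fun z => -Matrix.toEuclideanCLM (𝕜 := ℝ) B (g z)) =
      B * momentMatrix μ g * B.transpose := by
  ext a b
  have h1 : ∀ z, (-Matrix.toEuclideanCLM (𝕜 := ℝ) B (g z)) a *
      (-Matrix.toEuclideanCLM (𝕜 := ℝ) B (g z)) b =
        ∑ j, ∑ i, B a i * (g z i * g z j) * B b j := by
    intro z
    simp only [PiLp.neg_apply, neg_mul_neg, Matrix.ofLp_toEuclideanCLM, Matrix.mulVec, dotProduct]
    rw [Finset.sum_mul_sum, Finset.sum_comm]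
    refine Finset.sum_congr rfl fun j _ => Finset.sum_congr rfl fun i _ => by ring
  simp only [momentMatrix, Matrix.of_apply, h1, Matrix.mul_apply, Matrix.transpose_apply,
    Finset.sum_mul]
  rw [integral_finsetSum _ fun j _ => integrable_finsetSum _ fun i _ =>
    ((integrable_coord_mul_coord hg i j).const_mul _).mul_const _]
  refine Finset.sum_congr rfl fun j _ => ?_
  rw [integral_finsetSum _ fun i _ =>
    ((integrable_coord_mul_coord hg i j).const_mul _).mul_const _]
  refine Finset.sum_congr rfl fun i _ => ?_
  rw [integral_mul_const, integral_const_mul]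

/-- The linearization of a vanishing empirical gradient. -/
lemma IsRegularLoss.norm_sub_newton_le {f : E d → Z → ℝ} {θ₀ : E d} {r : ℝ} {L K : Z → ℝ}
    (h : IsRegularLoss μ f θ₀ r L K) {T : E d →L[ℝ] E d →L[ℝ] ℝ} {Ψ : (E d →L[ℝ] ℝ) →L[ℝ] E d}
    (hΨ : ∀ u, Ψ (T u) = u) {N : ℕ} {z : ℕ → Z} {θ : E d} (hθ : θ ∈ Metric.ball θ₀ r)
    (h0 : ∑ i ∈ Finset.range N, fderiv ℝ (fun θ => f θ (z i)) θ = 0) :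
    ‖(θ - θ₀) - (N : ℝ)⁻¹ • ∑ i ∈ Finset.range N, -Ψ (fderiv ℝ (fun θ => f θ (z i)) θ₀)‖ ≤
      (‖Ψ‖ * (‖(N : ℝ)⁻¹ • ∑ i ∈ Finset.range N, fderiv ℝ (fderiv ℝ fun θ => f θ (z i)) θ₀ - T‖
        + ((N : ℝ)⁻¹ • ∑ i ∈ Finset.range N, |K (z i)|) * ‖θ - θ₀‖)) * ‖θ - θ₀‖ := by
  set δ := θ - θ₀ with hδ
  set D₁ : ℕ → E d →L[ℝ] ℝ := fun i => fderiv ℝ (fun θ => f θ (z i)) θ₀ with hD₁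
  set D₂ : ℕ → E d →L[ℝ] E d →L[ℝ] ℝ := fun i => fderiv ℝ (fderiv ℝ fun θ => f θ (z i)) θ₀ with hD₂
  set R : ℕ → E d →L[ℝ] ℝ := fun i => fderiv ℝ (fun θ => f θ (z i)) θ - D₁ i - D₂ i δ with hR
  -- Expanding the vanishing gradient at `θ` around `θ₀` solves for the gradient at `θ₀`. Applying
  -- `Ψ`, a left inverse of the limiting Hessian `T`, leaves only the deviation of the empirical
  -- Hessian from `T` and the Taylor remainders.
  have hsum : ∑ i ∈ Finset.range N, D₁ i
      = -((∑ i ∈ Finset.range N, D₂ i) δ) - ∑ i ∈ Finset.range N, R i := by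
    simp only [hR, Finset.sum_sub_distrib, h0, sum_apply]
    abel
  have hRb : ‖∑ i ∈ Finset.range N, R i‖ ≤ (∑ i ∈ Finset.range N, |K (z i)|) * ‖δ‖ * ‖δ‖ := by
    rw [Finset.sum_mul, Finset.sum_mul]
    exact norm_sum_le_of_le _ fun i _ => h.norm_taylor_le (z i) hθ
  have hkey : δ - (N : ℝ)⁻¹ • ∑ i ∈ Finset.range N, -Ψ (D₁ i) =
      -Ψ (((N : ℝ)⁻¹ • ∑ i ∈ Finset.range N, D₂ i - T) δ
        + (N : ℝ)⁻¹ • ∑ i ∈ Finset.range N, R i) := by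
    rw [Finset.sum_neg_distrib, ← map_sum, hsum]
    simp only [map_add, map_smul, map_sub, map_neg, sub_apply,
      smul_apply, hΨ]
    module
  rw [hkey, norm_neg]
  refine (Ψ.le_opNorm _).trans ?_
  rw [mul_assoc]
  refine mul_le_mul_of_nonneg_left ?_ (norm_nonneg _)
  refine (norm_add_le _ _).trans ?_
  rw [add_mul]
  refine add_le_add (ContinuousLinearMap.le_opNorm _ _) ?_
  rw [norm_smul, Real.norm_of_nonneg (by positivity), smul_eq_mul, mul_assoc, mul_assoc]
  refine mul_le_mul_of_nonneg_left ?_ (by positivity)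
  rw [← mul_assoc]
  exact hRb

/-- Asymptotic normality of minimizers of an empirical risk over a compact parameter set. -/
theorem tendstoToNormal_argmin [IsProbabilityMeasure μ] {Θ : Set (E d)} (hΘ : IsCompact Θ)
    {f : E d → Z → ℝ} {L K : Z → ℝ} {θ₀ : E d} {r : ℝ} (hr : Metric.ball θ₀ r ⊆ Θ)
    (h : IsRegularLoss μ f θ₀ r L K) (hint : ∀ θ ∈ Θ, Integrable (f θ) μ)
    (hlip : ∀ z, ∀ a ∈ Θ, ∀ b ∈ Θ, |f a z - f b z| ≤ L z * ‖a - b‖)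
    (hmin : ∀ θ ∈ Θ, θ ≠ θ₀ → ∫ y, f θ₀ y ∂μ < ∫ y, f θ y ∂μ)
    (hinv : IsUnit (hess (fun θ => ∫ y, f θ y ∂μ) θ₀).det)
    {z : ℕ → Ω → Z} (hind : iIndepFun z P) (hlaw : ∀ i, HasLaw (z i) μ P) {t : ℕ → Ω → E d}
    (htm : ∀ N, AEMeasurable (t N) P) (ht : ∀ N, 0 < N → ∀ᵐ ω ∂P, t N ω ∈ Θ)
    (htmin : ∀ N, 0 < N → ∀ᵐ ω ∂P, ∀ θ ∈ Θ,
      ∑ i ∈ Finset.range N, f (t N ω) (z i ω) ≤ ∑ i ∈ Finset.range N, f θ (z i ω)) :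
    TendstoToNormal P (fun N ω => √(N : ℝ) • (t N ω - θ₀))
      ((hess (fun θ => ∫ y, f θ y ∂μ) θ₀)⁻¹
        * momentMatrix μ (fun y => gradient (fun θ => f θ y) θ₀)
        * (hess (fun θ => ∫ y, f θ y ∂μ) θ₀)⁻¹) := by
  set A := hess (fun θ => ∫ y, f θ y ∂μ) θ₀ with hA
  set T := ∫ y, fderiv ℝ (fderiv ℝ fun θ => f θ y) θ₀ ∂μ with hT
  have hθ₀ : θ₀ ∈ Θ := hr h.mem
  have hAT : ∀ i j, T (basisVec i) (basisVec j) = A i j := fun i j => (h.hess_integral i j).symm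
  have hTs := h.integral_fderiv_fderiv_symm
  have hAs : A⁻¹.transpose = A⁻¹ := by
    rw [Matrix.transpose_nonsing_inv]
    congr 1
    ext i j
    rw [Matrix.transpose_apply, ← hAT, ← hAT, hTs]
  let Ψ : (E d →L[ℝ] ℝ) →L[ℝ] E d := (Matrix.toEuclideanCLM (𝕜 := ℝ) A⁻¹).comp dualToVec
  have hΨ : ∀ u, Ψ (T u) = u := toEuclideanCLM_dualToVec hinv hAT hTs
  -- the leading term
  let Y : Z → E d := fun y => -Ψ (fderiv ℝ (fun θ => f θ y) θ₀)
  have hD := h.memLp_fderiv h.mem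
  have hgrad : ∀ y, gradient (fun θ => f θ y) θ₀ = dualToVec (fderiv ℝ (fun θ => f θ y) θ₀) :=
    fun y => by rw [gradient_eq_dualToVec]
  have hY : MemLp Y 2 μ := (Ψ.comp_memLp' hD).neg
  have hYm : momentMatrix μ Y = A⁻¹ * momentMatrix μ (fun y => gradient (fun θ => f θ y) θ₀)
      * A⁻¹ := by
    simp_rw [hgrad]
    have := momentMatrix_toEuclideanCLM (B := A⁻¹) (dualToVec.comp_memLp' hD)
    rwa [hAs] at this
  -- The leading term is centred because `θ₀` is an interior minimizer of the population risk.
  have hcrit : ∫ y, fderiv ℝ (fun θ => f θ y) θ₀ ∂μ = 0 := by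
    refine IsLocalMin.hasFDerivAt_eq_zero ?_ (h.hasFDerivAt_integral h.mem)
    filter_upwards [Metric.isOpen_ball.mem_nhds h.mem] with θ hθ
    by_cases hne : θ = θ₀
    · rw [hne]
    · exact (hmin θ (hr hθ) hne).le
  have hY0 : ∫ y, Y y ∂μ = 0 := by
    rw [integral_neg, Ψ.integral_comp_comm (hD.integrable (by norm_num)), hcrit]
    simp
  have hclt := tendstoToNormal_clt hY hY0 hind hlaw
  rw [hYm] at hclt
  refine ⟨hclt.1, ?_⟩
  have hcons : ∀ᵐ ω ∂P, Tendsto (fun N => t N ω) atTop (𝓝 θ₀) := by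
    refine ae_tendsto_argmin hΘ hθ₀ hint (h.memLp.integrable (by norm_num)) ?_ hmin hind hlaw ht ?_
    · simpa only [dist_eq_norm] using hlip
    · intro N hN
      filter_upwards [htmin N hN] with ω hω using hω θ₀ hθ₀
  have htae : ∀ᵐ ω ∂P, ∀ N, 0 < N → ∀ θ ∈ Θ,
      ∑ i ∈ Finset.range N, f (t N ω) (z i ω) ≤ ∑ i ∈ Finset.range N, f θ (z i ω) := by
    refine ae_all_iff.2 fun N => ?_
    by_cases hN : 0 < N
    · filter_upwards [htmin N hN] with ω h1 _ using h1
    · exact Eventually.of_forall fun ω h => absurd h hN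
  let ε : ℕ → Ω → ℝ := fun N ω => ‖Ψ‖ * (‖(N : ℝ)⁻¹ • ∑ i ∈ Finset.range N,
    fderiv ℝ (fderiv ℝ fun θ => f θ (z i ω)) θ₀ - T‖
      + ((N : ℝ)⁻¹ • ∑ i ∈ Finset.range N, |K (z i ω)|) * ‖t N ω - θ₀‖)
  refine tendstoInDistribution_of_norm_sub_le hclt.2
    (fun N => ((htm N).sub_const θ₀).const_smul (√(N : ℝ))) (ε := ε) ?_ ?_
  · filter_upwards [hcons, ae_tendsto_average h.integrable_fderiv_fderiv hind hlaw,
      ae_tendsto_average h.integrable_const.abs hind hlaw] with ω h1 h2 h3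
    have h4 := ((tendsto_iff_norm_sub_tendsto_zero.1 h2).add
      (h3.mul (tendsto_iff_norm_sub_tendsto_zero.1 h1))).const_mul ‖Ψ‖
    convert! h4 using 2
    simp
  · filter_upwards [hcons, htae] with ω h1 h2
    filter_upwards [eventually_gt_atTop 0, h1.eventually (Metric.isOpen_ball.mem_nhds h.mem)]
      with N hN hball
    -- By consistency the minimizer has entered the open ball inside `Θ`, so minimality over `Θ`
    -- makes it an unconstrained local minimum.
    have hscore : ∑ i ∈ Finset.range N, fderiv ℝ (fun θ => f θ (z i ω)) (t N ω) = 0 := by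
      have hd : HasFDerivAt (fun θ => ∑ i ∈ Finset.range N, f θ (z i ω))
          (∑ i ∈ Finset.range N, fderiv ℝ (fun θ => f θ (z i ω)) (t N ω)) (t N ω) :=
        HasFDerivAt.fun_sum fun i _ => h.hasFDerivAt (z i ω) hball
      refine IsLocalMin.hasFDerivAt_eq_zero ?_ hd
      filter_upwards [Metric.isOpen_ball.mem_nhds hball] with θ hθ using h2 N hN θ (hr hθ)
    have h3 := h.norm_sub_newton_le hΨ hball hscore
    have hN' : (0 : ℝ) < √(N : ℝ) := Real.sqrt_pos.2 (by exact_mod_cast hN)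
    have hNN : (√(N : ℝ))⁻¹ = √(N : ℝ) * (N : ℝ)⁻¹ := by
      rw [inv_eq_iff_eq_inv, mul_inv, inv_inv, inv_mul_eq_div, Real.div_sqrt]
    have h5 : √(N : ℝ) • (t N ω - θ₀) - (√(N : ℝ))⁻¹ • ∑ i ∈ Finset.range N, Y (z i ω) =
        √(N : ℝ) • ((t N ω - θ₀) - (N : ℝ)⁻¹ • ∑ i ∈ Finset.range N, Y (z i ω)) := by
      rw [hNN, mul_smul]
      exact (smul_sub _ _ _).symm
    show ‖√(N : ℝ) • (t N ω - θ₀) - (√(N : ℝ))⁻¹ • ∑ i ∈ Finset.range N, Y (z i ω)‖ ≤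
      ε N ω * ‖√(N : ℝ) • (t N ω - θ₀)‖
    rw [h5, norm_smul, norm_smul, mul_left_comm]
    exact mul_le_mul_of_nonneg_left h3 (norm_nonneg _)

end MEstimation

/-! ### Integration against a positive density -/

section Density

variable {D : ℕ} {p : E D → ℝ}

lemma isProbabilityMeasure_densityMeasure (hp : ∀ x, 0 < p x) (h1 : ∫ x, p x = 1) :
    IsProbabilityMeasure (densityMeasure p) := by
  refine ⟨?_⟩
  -- Integrability follows from the integral being nonzero, since the integral of a nonintegrable
  -- function is `0` by convention.
  rw [densityMeasure, withDensity_apply _ MeasurableSet.univ, Measure.restrict_univ,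
    ← ofReal_integral_eq_lintegral_ofReal (Integrable.of_integral_ne_zero (by simp [h1]))
      (Eventually.of_forall fun x => (hp x).le), h1, ENNReal.ofReal_one]

lemma integral_densityMeasure (hp : ∀ x, 0 < p x) (hc : Continuous p) (g : E D → ℝ) :
    ∫ x, g x ∂(densityMeasure p) = ∫ x, p x * g x := by
  rw [densityMeasure, integral_withDensity_eq_integral_toReal_smul
    hc.measurable.ennreal_ofReal (Eventually.of_forall fun x => by simp)]
  simp [(hp _).le]

lemma integrable_densityMeasure_iff (hp : ∀ x, 0 < p x) (hc : Continuous p) {g : E D → ℝ} :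
    Integrable g (densityMeasure p) ↔ Integrable (fun x => p x * g x) := by
  rw [densityMeasure, integrable_withDensity_iff_integrable_smul'
    hc.measurable.ennreal_ofReal (Eventually.of_forall fun x => by simp)]
  simp [(hp _).le]

lemma ae_of_ae_densityMeasure (hp : ∀ x, 0 < p x) (hc : Continuous p) {q : E D → Prop}
    (h : ∀ᵐ x ∂(densityMeasure p), q x) : ∀ᵐ x, q x :=
  (withDensity_absolutelyContinuous' hc.measurable.ennreal_ofReal.aemeasurable
    (Eventually.of_forall fun x => by simpa using hp x)).ae_le h

end Density

/-! ### Integration by parts and identifiability -/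

section Score

variable {d D : ℕ} {pm : E d → E D → ℝ} {θ θ₀ : E d}

lemma inner_fderiv_score (x v : E D) :
    ∑ i, ∑ j, v i * scoreJacobian pm θ x i j * v j = inner ℝ (fderiv ℝ (score pm θ) x v) v := by
  have h1 : fderiv ℝ (score pm θ) x v = ∑ i, v i • fderiv ℝ (score pm θ) x (basisVec i) := by
    conv_lhs => rw [eq_sum_smul_basisVec v]
    simp [map_sum]
  rw [h1, PiLp.inner_apply, Finset.sum_comm]
  refine Finset.sum_congr rfl fun j _ => ?_
  simp only [WithLp.ofLp_sum, Finset.sum_apply, PiLp.smul_apply, smul_eq_mul,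
    RCLike.inner_apply, conj_trivial, Finset.mul_sum]
  refine Finset.sum_congr rfl fun i _ => ?_
  rw [scoreJacobian, hess, Matrix.of_apply]
  exact mul_comm _ _

lemma slicedLoss_eq_inner (x v : E D) :
    slicedLoss pm θ x v = inner ℝ (fderiv ℝ (score pm θ) x v) v
      + 1 / 2 * (inner ℝ (score pm θ x) v) ^ 2 := by
  rw [slicedLoss, inner_fderiv_score]
  simp [PiLp.inner_apply]

lemma eq_exp_logDensity (hp : ∀ x, 0 < pm θ x) (x : E D) :
    pm θ x = Real.exp (logDensity pm θ x) := by
  rw [logDensity, Real.exp_log (hp x)]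

lemma hasGradientAt_logDensity (h : Differentiable ℝ (logDensity pm θ)) (x : E D) :
    HasGradientAt (logDensity pm θ) (score pm θ x) x :=
  (h x).hasGradientAt

lemma hasFDerivAt_density (hp : ∀ x, 0 < pm θ x) (h : Differentiable ℝ (logDensity pm θ))
    (x : E D) : HasFDerivAt (pm θ) (pm θ x • innerSL ℝ (score pm θ x)) x := by
  have h1 := (hasGradientAt_logDensity h x).hasFDerivAt.exp
  rw [← eq_exp_logDensity hp] at h1
  have h2 : (fun x => Real.exp (logDensity pm θ x)) = pm θ :=
    funext fun x => (eq_exp_logDensity hp x).symm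
  rw [h2] at h1
  exact h1

lemma continuous_density (hp : ∀ x, 0 < pm θ x) (h : Differentiable ℝ (logDensity pm θ)) :
    Continuous (pm θ) :=
  continuous_iff_continuousAt.2 fun x => (hasFDerivAt_density hp h x).continuousAt

lemma memLp_score {p : E D → ℝ} (hs : Differentiable ℝ (score pm θ))
    (h : Integrable (fun x => ‖score pm θ x‖ ^ 2) (densityMeasure p)) :
    MemLp (score pm θ) 2 (densityMeasure p) :=
  (memLp_two_iff_integrable_sq_norm hs.continuous.aestronglyMeasurable).2 h

/-- Integration by parts in the direction of the projection vector. -/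
lemma integral_slicedLoss_eq (hp : ∀ x, 0 < pm θ₀ x) (hl : Differentiable ℝ (logDensity pm θ₀))
    (hs : Differentiable ℝ (score pm θ))
    (hs₀L : MemLp (score pm θ₀) 2 (densityMeasure (pm θ₀)))
    (hsL : MemLp (score pm θ) 2 (densityMeasure (pm θ₀))) {v : E D}
    (hint : Integrable (fun x => slicedLoss pm θ x v) (densityMeasure (pm θ₀)))
    [IsProbabilityMeasure (densityMeasure (pm θ₀))] :
    ∫ x, slicedLoss pm θ x v ∂(densityMeasure (pm θ₀)) =
      ∫ x, (1 / 2 * (inner ℝ (score pm θ x) v) ^ 2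
        - inner ℝ (score pm θ₀ x) v * inner ℝ (score pm θ x) v) ∂(densityMeasure (pm θ₀)) := by
  have hc := continuous_density hp hl
  have h1 : MemLp (fun x => inner ℝ (score pm θ x) v) 2 (densityMeasure (pm θ₀)) :=
    hsL.inner_const v
  have h2 : MemLp (fun x => inner ℝ (score pm θ₀ x) v) 2 (densityMeasure (pm θ₀)) :=
    hs₀L.inner_const v
  have h3 : Integrable (fun x => inner ℝ (score pm θ₀ x) v * inner ℝ (score pm θ x) v)
      (densityMeasure (pm θ₀)) := h2.integrable_mul h1
  have h4 : Integrable (fun x => 1 / 2 * (inner ℝ (score pm θ x) v) ^ 2)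
      (densityMeasure (pm θ₀)) := h1.integrable_sq.const_mul _
  -- The second-derivative term is the integrable loss minus the integrable square.
  have h5 : Integrable (fun x => inner ℝ (fderiv ℝ (score pm θ) x v) v)
      (densityMeasure (pm θ₀)) := by
    refine (hint.sub h4).congr (Eventually.of_forall fun x => ?_)
    simp [slicedLoss_eq_inner]
  have hg : ∀ x, HasFDerivAt (fun x => inner ℝ (score pm θ x) v)
      ((innerSL ℝ v).comp (fderiv ℝ (score pm θ) x)) x := fun x => by
    have := (innerSL ℝ v).hasFDerivAt.comp x (hs x).hasFDerivAt
    refine this.congr_of_eventuallyEq (Eventually.of_forall fun y => ?_)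
    simp [real_inner_comm]
  -- The directional derivative of `p_d ⟨s, v⟩` integrates to zero because this product and both
  -- terms of its product rule are integrable. The derivative of the density is `p_d` times its own
  -- score.
  have h6 := integral_bilinear_hasFDerivAt_right_eq_neg_left_of_integrable (μ := volume)
    (B := ContinuousLinearMap.mul ℝ ℝ) (f := pm θ₀) (g := fun x => inner ℝ (score pm θ x) v)
    (v := v) (f' := fun x => pm θ₀ x • innerSL ℝ (score pm θ₀ x))
    (g' := fun x => (innerSL ℝ v).comp (fderiv ℝ (score pm θ) x))
    (by simpa [mul_assoc] using (integrable_densityMeasure_iff hp hc).1 h3)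
    (by simpa [real_inner_comm] using (integrable_densityMeasure_iff hp hc).1 h5)
    (by simpa using (integrable_densityMeasure_iff hp hc).1 (h1.integrable (by norm_num)))
    (fun x _ => hasFDerivAt_density hp hl x) (fun x _ => hg x)
  have h7 : ∫ x, inner ℝ (fderiv ℝ (score pm θ) x v) v ∂(densityMeasure (pm θ₀)) =
      -∫ x, inner ℝ (score pm θ₀ x) v * inner ℝ (score pm θ x) v ∂(densityMeasure (pm θ₀)) := by
    rw [integral_densityMeasure hp hc, integral_densityMeasure hp hc]
    simpa [real_inner_comm, mul_assoc] using h6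
  simp_rw [slicedLoss_eq_inner]
  rw [integral_add h5 h4, integral_sub h4 h3, h7]
  ring

/-- With `a = ⟨s(θ), v⟩` and `b = ⟨s(θ₀), v⟩`, the two integrands are `½a² - ba` and `½b² - b²`, and
their difference is the square `½(a - b)²`. -/
lemma integral_slicedLoss_sub (hp : ∀ x, 0 < pm θ₀ x) (hl : Differentiable ℝ (logDensity pm θ₀))
    (hs₀ : Differentiable ℝ (score pm θ₀)) (hs : Differentiable ℝ (score pm θ))
    (hs₀L : MemLp (score pm θ₀) 2 (densityMeasure (pm θ₀)))
    (hsL : MemLp (score pm θ) 2 (densityMeasure (pm θ₀))) {v : E D}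
    (hint₀ : Integrable (fun x => slicedLoss pm θ₀ x v) (densityMeasure (pm θ₀)))
    (hint : Integrable (fun x => slicedLoss pm θ x v) (densityMeasure (pm θ₀)))
    [IsProbabilityMeasure (densityMeasure (pm θ₀))] :
    ∫ x, slicedLoss pm θ x v ∂(densityMeasure (pm θ₀))
      - ∫ x, slicedLoss pm θ₀ x v ∂(densityMeasure (pm θ₀)) =
      ∫ x, 1 / 2 * (inner ℝ (score pm θ x - score pm θ₀ x) v) ^ 2
        ∂(densityMeasure (pm θ₀)) := by
  have h1 : MemLp (fun x => inner ℝ (score pm θ x) v) 2 (densityMeasure (pm θ₀)) :=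
    hsL.inner_const v
  have h2 : MemLp (fun x => inner ℝ (score pm θ₀ x) v) 2 (densityMeasure (pm θ₀)) :=
    hs₀L.inner_const v
  rw [integral_slicedLoss_eq hp hl hs hs₀L hsL hint,
    integral_slicedLoss_eq hp hl hs₀ hs₀L hs₀L hint₀, ← integral_sub]
  · refine integral_congr_ae (Eventually.of_forall fun x => ?_)
    simp only [inner_sub_left]
    ring
  · exact (h1.integrable_sq.const_mul _).sub (h2.integrable_mul h1)
  · exact (h2.integrable_sq.const_mul _).sub (h2.integrable_mul h2)

/-- Equal scores of normalized densities imply equal densities. -/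
lemma density_eq_of_score_eq (hp : ∀ x, 0 < pm θ x) (hp₀ : ∀ x, 0 < pm θ₀ x)
    (hl : Differentiable ℝ (logDensity pm θ)) (hl₀ : Differentiable ℝ (logDensity pm θ₀))
    (h1 : ∫ x, pm θ x = 1) (h1₀ : ∫ x, pm θ₀ x = 1) (hs : score pm θ = score pm θ₀) :
    pm θ = pm θ₀ := by
  have hd : ∀ x, HasFDerivAt (fun x => logDensity pm θ x - logDensity pm θ₀ x)
      (0 : E D →L[ℝ] ℝ) x := fun x => by
    have := (hasGradientAt_logDensity hl x).hasFDerivAt.sub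
      (hasGradientAt_logDensity hl₀ x).hasFDerivAt
    rwa [hs, sub_self] at this
  have hc : ∀ x, logDensity pm θ x - logDensity pm θ₀ x =
      logDensity pm θ 0 - logDensity pm θ₀ 0 := fun x =>
    is_const_of_fderiv_eq_zero (𝕜 := ℝ) (fun x => (hd x).differentiableAt)
      (fun x => (hd x).fderiv) x 0
  set c := logDensity pm θ 0 - logDensity pm θ₀ 0
  have he : ∀ x, pm θ x = Real.exp c * pm θ₀ x := fun x => by
    rw [eq_exp_logDensity hp, eq_exp_logDensity hp₀, ← Real.exp_add, ← hc x]
    congr 1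
    ring
  have hc1 : Real.exp c = 1 := by
    simp_rw [he] at h1
    rwa [integral_const_mul, h1₀, mul_one] at h1
  funext x
  rw [he, hc1, one_mul]

/-- A parameter whose sliced objective does not exceed that of the data parameter has the same
density. -/
theorem density_eq_of_slicedObjective_le (hp : ∀ x, 0 < pm θ x) (hp₀ : ∀ x, 0 < pm θ₀ x)
    (hl : Differentiable ℝ (logDensity pm θ)) (hl₀ : Differentiable ℝ (logDensity pm θ₀))
    (hs : Differentiable ℝ (score pm θ)) (hs₀ : Differentiable ℝ (score pm θ₀))
    (h1 : ∫ x, pm θ x = 1) (h1₀ : ∫ x, pm θ₀ x = 1)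
    (hsL : MemLp (score pm θ) 2 (densityMeasure (pm θ₀)))
    (hs₀L : MemLp (score pm θ₀) 2 (densityMeasure (pm θ₀)))
    {pv : Measure (E D)} [IsProbabilityMeasure pv] (hv : Integrable (fun v : E D => ‖v‖ ^ 2) pv)
    (hS : (secondMoment pv).PosDef)
    (hint : Integrable (fun z : E D × E D => slicedLoss pm θ z.1 z.2)
      ((densityMeasure (pm θ₀)).prod pv))
    (hint₀ : Integrable (fun z : E D × E D => slicedLoss pm θ₀ z.1 z.2)
      ((densityMeasure (pm θ₀)).prod pv))
    (hle : slicedObjective pm (pm θ₀) pv θ ≤ slicedObjective pm (pm θ₀) pv θ₀) :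
    pm θ = pm θ₀ := by
  have hμ := isProbabilityMeasure_densityMeasure hp₀ h1₀
  have hc₀ := continuous_density hp₀ hl₀
  set u : E D → E D := fun x => score pm θ x - score pm θ₀ x with hu
  have huc : Continuous u := hs.continuous.sub hs₀.continuous
  have huL : MemLp u 2 (densityMeasure (pm θ₀)) := hsL.sub hs₀L
  have hidL : MemLp (fun v : E D => v) 2 pv :=
    (memLp_two_iff_integrable_sq_norm (by fun_prop)).2 hv
  -- Cauchy–Schwarz bounds the integrand by `‖u‖² ‖v‖²`, which justifies the exchange of integrals
  -- below.
  have hprod : Integrable (fun z : E D × E D => (inner ℝ (u z.1) z.2) ^ 2)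
      ((densityMeasure (pm θ₀)).prod pv) := by
    refine (huL.integrable_norm_pow (by norm_num)).mul_prod hv |>.mono'
      (by fun_prop) (Eventually.of_forall fun z => ?_)
    rw [Real.norm_of_nonneg (sq_nonneg _), ← mul_pow, ← sq_abs]
    exact pow_le_pow_left₀ (abs_nonneg _) (abs_real_inner_le_norm _ _) 2
  have hdiff : slicedObjective pm (pm θ₀) pv θ - slicedObjective pm (pm θ₀) pv θ₀ =
      1 / 2 * ∫ x, (u x).ofLp ⬝ᵥ (secondMoment pv).mulVec (u x).ofLp
        ∂(densityMeasure (pm θ₀)) := by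
    rw [slicedObjective, slicedObjective,
      ← integral_sub hint.integral_prod_right hint₀.integral_prod_right]
    have e1 : ∀ᵐ v ∂pv, ∫ x, slicedLoss pm θ x v ∂(densityMeasure (pm θ₀))
        - ∫ x, slicedLoss pm θ₀ x v ∂(densityMeasure (pm θ₀)) =
        ∫ x, 1 / 2 * (inner ℝ (u x) v) ^ 2 ∂(densityMeasure (pm θ₀)) := by
      filter_upwards [hint.prod_left_ae, hint₀.prod_left_ae] with v hv1 hv2
      exact integral_slicedLoss_sub hp₀ hl₀ hs₀ hs hs₀L hsL hv2 hv1
    rw [integral_congr_ae e1, integral_integral_swap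
      (f := fun v x => 1 / 2 * (inner ℝ (u x) v) ^ 2) (hprod.const_mul (1 / 2)).swap,
      ← integral_const_mul]
    refine integral_congr_ae (Eventually.of_forall fun x => ?_)
    simp only
    rw [integral_const_mul]
    congr 1
    have := integral_inner_sq hidL (u x)
    simp_rw [real_inner_comm (u x)] at this
    exact this
  have hq0 : ∀ x, 0 ≤ (u x).ofLp ⬝ᵥ (secondMoment pv).mulVec (u x).ofLp := fun x => by
    simpa using hS.posSemidef.dotProduct_mulVec_nonneg (u x).ofLp
  have hqint : Integrable (fun x => (u x).ofLp ⬝ᵥ (secondMoment pv).mulVec (u x).ofLp)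
      (densityMeasure (pm θ₀)) := by
    refine hprod.integral_prod_left.congr (Eventually.of_forall fun x => ?_)
    have := integral_inner_sq hidL (u x)
    simp_rw [real_inner_comm (u x)] at this
    exact this
  have hq : ∫ x, (u x).ofLp ⬝ᵥ (secondMoment pv).mulVec (u x).ofLp
      ∂(densityMeasure (pm θ₀)) = 0 :=
    le_antisymm (by linarith) (integral_nonneg hq0)
  have hae := (integral_eq_zero_iff_of_nonneg hq0 hqint).1 hq
  -- Positivity of the density turns null sets of `p_d` into Lebesgue null sets; continuity of `u`
  -- then removes the exceptional set.
  have hu0 : u =ᵐ[volume] fun _ => 0 := by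
    refine ae_of_ae_densityMeasure hp₀ hc₀ ?_
    filter_upwards [hae] with x hx
    by_contra hne
    have h2 := hS.dotProduct_mulVec_pos (x := (u x).ofLp) (by
      intro h0
      exact hne (by ext i; simp [h0]))
    simp only [star_trivial] at h2
    exact h2.ne' hx
  have hu00 := (huc.ae_eq_iff_eq volume continuous_const).1 hu0
  exact density_eq_of_score_eq hp hp₀ hl hl₀ h1 h1₀
    (funext fun x => sub_eq_zero.1 (congrFun hu00 x))

end Score

/-! ### Second derivatives of linear combinations -/

section Differentials

set_option maxSynthPendingDepth 3

variable {d : ℕ} {s : Set (E d)}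

lemma hasFDerivAt_of_contDiffOn {h : E d → ℝ} (hs : IsOpen s) (hh : ContDiffOn ℝ 2 h s)
    {θ : E d} (hθ : θ ∈ s) : HasFDerivAt h (fderiv ℝ h θ) θ :=
  ((hh.contDiffAt (hs.mem_nhds hθ)).differentiableAt (by norm_num)).hasFDerivAt

lemma hasFDerivAt_fderiv_of_contDiffOn {h : E d → ℝ} (hs : IsOpen s)
    (hh : ContDiffOn ℝ 2 h s) {θ : E d} (hθ : θ ∈ s) :
    HasFDerivAt (fderiv ℝ h) (fderiv ℝ (fderiv ℝ h) θ) θ :=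
  (((hh.contDiffAt (hs.mem_nhds hθ)).fderiv_right (m := 1) (by norm_num)).differentiableAt
    (by norm_num)).hasFDerivAt

lemma fderiv_sum_mul {ι : Type*} {u : Finset ι} {c : ι → ℝ} {h : ι → E d → ℝ} (hs : IsOpen s)
    (hh : ∀ i, ContDiffOn ℝ 2 (h i) s) {θ : E d} (hθ : θ ∈ s) :
    fderiv ℝ (fun θ => ∑ i ∈ u, c i * h i θ) θ = ∑ i ∈ u, c i • fderiv ℝ (h i) θ :=
  (HasFDerivAt.fun_sum fun i _ =>
    (hasFDerivAt_of_contDiffOn hs (hh i) hθ).const_mul (c i)).fderiv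

lemma fderiv_fderiv_sum_mul {ι : Type*} {u : Finset ι} {c : ι → ℝ} {h : ι → E d → ℝ}
    (hs : IsOpen s) (hh : ∀ i, ContDiffOn ℝ 2 (h i) s) {θ : E d} (hθ : θ ∈ s) :
    fderiv ℝ (fderiv ℝ fun θ => ∑ i ∈ u, c i * h i θ) θ =
      ∑ i ∈ u, c i • fderiv ℝ (fderiv ℝ (h i)) θ := by
  have he : (fderiv ℝ fun θ => ∑ i ∈ u, c i * h i θ) =ᶠ[𝓝 θ]
      fun θ => ∑ i ∈ u, c i • fderiv ℝ (h i) θ := by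
    filter_upwards [hs.mem_nhds hθ] with θ' hθ' using fderiv_sum_mul hs hh hθ'
  rw [he.fderiv_eq]
  exact (HasFDerivAt.fun_sum fun i _ =>
    (hasFDerivAt_fderiv_of_contDiffOn hs (hh i) hθ).const_smul (c i)).fderiv

lemma norm_fderiv_fderiv_sub_le {h : E d → ℝ} (hs : IsOpen s) (hh : ContDiffOn ℝ 2 h s)
    {a b : E d} (ha : a ∈ s) (hb : b ∈ s) :
    ‖fderiv ℝ (fderiv ℝ h) a - fderiv ℝ (fderiv ℝ h) b‖ ≤
      d * (d * frobeniusNorm (hess h a - hess h b)) := by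
  have h0 := frobeniusNorm_nonneg (hess h a - hess h b)
  refine norm_le_of_apply_basisVec _ (fun i => norm_le_of_apply_basisVec _ (fun j => ?_) h0)
    (by positivity)
  have := abs_apply_le_frobeniusNorm (hess h a - hess h b) i j
  rwa [Matrix.sub_apply,
    hess_apply (hasFDerivAt_fderiv_of_contDiffOn hs hh ha).differentiableAt,
    hess_apply (hasFDerivAt_fderiv_of_contDiffOn hs hh hb).differentiableAt] at this

end Differentials

/-! ### Moments of averaged outer products -/

section ProductMoments

lemma memLp_two_mul_prod {X Y : Type*} [MeasurableSpace X] [MeasurableSpace Y] {μ : Measure X}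
    {ν : Measure Y} [SFinite μ] [SFinite ν] {a : X → ℝ} {b : Y → ℝ} (ha : MemLp a 2 μ)
    (hb : MemLp b 2 ν) : MemLp (fun z : X × Y => a z.1 * b z.2) 2 (μ.prod ν) := by
  refine (memLp_two_iff_integrable_sq (ha.1.comp_fst.mul hb.1.comp_snd)).2 ?_
  simpa only [Pi.mul_apply, mul_pow] using ha.integrable_sq.mul_prod hb.integrable_sq

variable {D M : ℕ} {pv : Measure (E D)}

/-- The average of the matrices `w_k w_kᵀ`. -/
def avgOuter (w : Fin M → E D) (i j : Fin D) : ℝ := 1 / (M : ℝ) * ∑ k, w k i * w k j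

/-- The average of the squared norms `‖w_k‖²`. -/
def avgSq (w : Fin M → E D) : ℝ := 1 / (M : ℝ) * ∑ k, ‖w k‖ ^ 2

lemma abs_coord_mul_coord_le (v : E D) (i j : Fin D) : |v i * v j| ≤ ‖v‖ ^ 2 := by
  rw [abs_mul, sq]
  exact mul_le_mul (PiLp.norm_apply_le v i) (PiLp.norm_apply_le v j) (abs_nonneg _)
    (norm_nonneg _)

lemma abs_avgOuter_le (w : Fin M → E D) (i j : Fin D) : |avgOuter w i j| ≤ avgSq w := by
  rw [avgOuter, avgSq, abs_mul, abs_of_nonneg (by positivity : (0 : ℝ) ≤ 1 / M)]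
  refine mul_le_mul_of_nonneg_left ?_ (by positivity)
  exact (Finset.abs_sum_le_sum_abs _ _).trans
    (Finset.sum_le_sum fun k _ => abs_coord_mul_coord_le _ _ _)

lemma frobeniusNorm_outer_sq (v : E D) : frobeniusNorm (outer v) ^ 2 = (‖v‖ ^ 2) ^ 2 := by
  rw [frobeniusNorm_sq, EuclideanSpace.real_norm_sq_eq, sq (∑ i, _), Finset.sum_mul_sum]
  simp [outer, mul_pow]

lemma memLp_norm_sq (h : Integrable (fun v : E D => frobeniusNorm (outer v) ^ 2) pv) :
    MemLp (fun v : E D => ‖v‖ ^ 2) 2 pv := by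
  refine (memLp_two_iff_integrable_sq (by fun_prop)).2 ?_
  simpa only [frobeniusNorm_outer_sq] using h

lemma memLp_coord_mul_coord (h : MemLp (fun v : E D => ‖v‖ ^ 2) 2 pv) (i j : Fin D) :
    MemLp (fun v : E D => v i * v j) 2 pv :=
  h.of_le (by fun_prop) (Eventually.of_forall fun v => by
    simpa using abs_coord_mul_coord_le v i j)

variable [IsProbabilityMeasure pv]

lemma memLp_avgSq (h : MemLp (fun v : E D => ‖v‖ ^ 2) 2 pv) :
    MemLp (avgSq (D := D) (M := M)) 2 (Measure.pi fun _ : Fin M => pv) :=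
  (memLp_finsetSum _ fun k _ =>
    h.comp_measurePreserving (measurePreserving_eval (fun _ : Fin M => pv) k)).const_mul _

lemma memLp_avgOuter (h : MemLp (fun v : E D => ‖v‖ ^ 2) 2 pv) (i j : Fin D) :
    MemLp (fun w : Fin M → E D => avgOuter w i j) 2 (Measure.pi fun _ : Fin M => pv) :=
  (memLp_finsetSum _ fun k _ => (memLp_coord_mul_coord h i j).comp_measurePreserving
    (measurePreserving_eval (fun _ : Fin M => pv) k)).const_mul _

/-- Distinct projections are independent, so the expectation factors; a single projection
contributes its own fourth moment. -/
lemma integral_pi_mul (i j p q : Fin D) (k l : Fin M) :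
    ∫ w : Fin M → E D, (w k i * w k j) * (w l p * w l q) ∂(Measure.pi fun _ => pv) =
      if k = l then fourthMoment pv i j p q else secondMoment pv i j * secondMoment pv p q := by
  have hk : ∀ k : Fin M, MeasurePreserving (Function.eval k) (Measure.pi fun _ : Fin M => pv) pv :=
    fun k => measurePreserving_eval (fun _ : Fin M => pv) k
  have hint : ∀ (k : Fin M) (g : E D → ℝ), Measurable g →
      ∫ w : Fin M → E D, g (w k) ∂(Measure.pi fun _ => pv) = ∫ v, g v ∂pv := fun k g hg => by
    conv_rhs => rw [← (hk k).map_eq]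
    rw [integral_map (hk k).measurable.aemeasurable hg.aestronglyMeasurable]
  split_ifs with hkl
  · subst hkl
    rw [hint k (fun v => (v i * v j) * (v p * v q)) (by fun_prop), fourthMoment]
    simp only [mul_assoc]
  · have hind : iIndepFun (fun (k : Fin M) (w : Fin M → E D) => w k)
        (Measure.pi fun _ : Fin M => pv) :=
      iIndepFun_pi (X := fun _ v => v) fun _ => aemeasurable_id
    have h2 := (hind.indepFun hkl).comp (φ := fun v : E D => v i * v j)
      (ψ := fun v : E D => v p * v q) (by fun_prop) (by fun_prop)
    have h3 := h2.integral_fun_mul_eq_mul_integral (by fun_prop) (by fun_prop)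
    refine h3.trans ?_
    have e1 := hint k (fun v => v i * v j) (by fun_prop)
    have e2 := hint l (fun v => v p * v q) (by fun_prop)
    simp only [Function.comp_def, secondMoment, Matrix.of_apply]
    rw [e1, e2]

lemma integral_avgOuter_mul_avgOuter (h : MemLp (fun v : E D => ‖v‖ ^ 2) 2 pv) (hM : 0 < M)
    (i j p q : Fin D) :
    ∫ w : Fin M → E D, avgOuter w i j * avgOuter w p q ∂(Measure.pi fun _ => pv) =
      (1 - 1 / (M : ℝ)) * (secondMoment pv i j * secondMoment pv p q)
        + 1 / (M : ℝ) * fourthMoment pv i j p q := by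
  have h1 : ∀ w : Fin M → E D, avgOuter w i j * avgOuter w p q =
      (1 / (M : ℝ)) ^ 2 * ∑ k, ∑ l, (w k i * w k j) * (w l p * w l q) := fun w => by
    rw [avgOuter, avgOuter, ← Finset.sum_mul_sum]
    ring
  have hL : ∀ (k : Fin M) (i j : Fin D), MemLp (fun w : Fin M → E D => w k i * w k j) 2
      (Measure.pi fun _ => pv) := fun k i j => (memLp_coord_mul_coord h i j).comp_measurePreserving
    (measurePreserving_eval (fun _ : Fin M => pv) k)
  have hi : ∀ k l : Fin M, Integrable
      (fun w : Fin M → E D => (w k i * w k j) * (w l p * w l q)) (Measure.pi fun _ => pv) :=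
    fun k l => (hL k i j).integrable_mul (hL l p q)
  simp_rw [h1]
  rw [integral_const_mul, integral_finsetSum _ fun k _ => integrable_finsetSum _ fun l _ => hi k l]
  -- For fixed `k`, all `M` indices `l` are counted as independent and the single term `l = k` is
  -- corrected.
  have h2 : ∀ k : Fin M, ∫ w : Fin M → E D, ∑ l, (w k i * w k j) * (w l p * w l q)
      ∂(Measure.pi fun _ => pv) =
      M * (secondMoment pv i j * secondMoment pv p q)
        + (fourthMoment pv i j p q - secondMoment pv i j * secondMoment pv p q) := fun k => by
    rw [integral_finsetSum _ fun l _ => hi k l]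
    simp_rw [integral_pi_mul]
    have : ∀ l : Fin M, (if k = l then fourthMoment pv i j p q
        else secondMoment pv i j * secondMoment pv p q) =
        secondMoment pv i j * secondMoment pv p q + if k = l then
          (fourthMoment pv i j p q - secondMoment pv i j * secondMoment pv p q) else 0 := by
      intro l
      split_ifs <;> ring
    simp_rw [this]
    rw [Finset.sum_add_distrib]
    simp
  simp_rw [h2]
  have hM' : (M : ℝ) ≠ 0 := by positivity
  simp only [Finset.sum_const, Finset.card_univ, Fintype.card_fin, nsmul_eq_mul]
  field_simp
  ring

end ProductMoments

/-! ### The loss of one observation: integrability, Lipschitz bounds, smoothness -/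

section SampleLoss

set_option maxSynthPendingDepth 3

variable {d D M : ℕ} {pm : E d → E D → ℝ}

/-- The coefficient of `vᵢ vⱼ` in the sliced loss. -/
def lossEntry (pm : E d → E D → ℝ) (x : E D) (i j : Fin D) (θ : E d) : ℝ :=
  secondPartial pm x i j θ + 1 / 2 * partialProd pm x i j θ

lemma slicedLoss_eq_sum (θ : E d) (x v : E D) :
    slicedLoss pm θ x v = ∑ i, ∑ j, v i * v j * lossEntry pm x i j θ := by
  rw [slicedLoss, sq, Finset.sum_mul_sum, Finset.mul_sum, ← Finset.sum_add_distrib]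
  refine Finset.sum_congr rfl fun i _ => ?_
  rw [Finset.mul_sum, ← Finset.sum_add_distrib]
  refine Finset.sum_congr rfl fun j _ => ?_
  rw [lossEntry, secondPartial, partialProd]
  ring

/-- The loss of a data point together with its `M` projection vectors. -/
def sampleLoss (pm : E d → E D → ℝ) (M : ℕ) (θ : E d) (z : E D × (Fin M → E D)) : ℝ :=
  1 / (M : ℝ) * ∑ k, slicedLoss pm θ z.1 (z.2 k)

/-- The separation of variables on which the rest depends: the weights involve only the projections,
the entries only `x` and `θ`. Regularity in `θ` passes from the entries to the loss, and
expectations factor. -/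
lemma sampleLoss_eq_sum (θ : E d) (z : E D × (Fin M → E D)) :
    sampleLoss pm M θ z =
      ∑ ij : Fin D × Fin D, avgOuter z.2 ij.1 ij.2 * lossEntry pm z.1 ij.1 ij.2 θ := by
  rw [sampleLoss, Fintype.sum_prod_type]
  simp_rw [slicedLoss_eq_sum, avgOuter]
  rw [Finset.sum_comm, Finset.mul_sum]
  refine Finset.sum_congr rfl fun i _ => ?_
  rw [Finset.sum_comm, Finset.mul_sum]
  refine Finset.sum_congr rfl fun j _ => ?_
  rw [← Finset.sum_mul, mul_assoc]

lemma empiricalObjective_eq (N : ℕ) (x : ℕ → E D) (v : ℕ → Fin M → E D) (θ : E d) :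
    empiricalObjective pm N M x v θ =
      1 / (N : ℝ) * ∑ i ∈ Finset.range N, sampleLoss pm M θ (x i, v i) := by
  rw [empiricalObjective, mul_assoc, Finset.mul_sum]
  rfl

/-- The law of a data point together with its projection vectors. -/
abbrev sampleLaw (M : ℕ) (pd : E D → ℝ) (pv : Measure (E D)) [SigmaFinite pv] :
    Measure (E D × (Fin M → E D)) :=
  (densityMeasure pd).prod (Measure.pi fun _ : Fin M => pv)

section Integrability

variable {pd : E D → ℝ} [IsProbabilityMeasure (densityMeasure pd)] {pv : Measure (E D)}
  [IsProbabilityMeasure pv]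

lemma measurePreserving_sampleLaw (k : Fin M) :
    MeasurePreserving (fun z : E D × (Fin M → E D) => (z.1, z.2 k)) (sampleLaw M pd pv)
      ((densityMeasure pd).prod pv) :=
  (MeasurePreserving.id _).prod (measurePreserving_eval (fun _ : Fin M => pv) k)

variable {θ : E d} (h : Integrable (fun z : E D × E D => slicedLoss pm θ z.1 z.2)
  ((densityMeasure pd).prod pv))

include h

lemma integrable_slicedLoss_eval (k : Fin M) :
    Integrable (fun z : E D × (Fin M → E D) => slicedLoss pm θ z.1 (z.2 k))
      (sampleLaw M pd pv) :=
  ((measurePreserving_sampleLaw k).integrable_comp h.aestronglyMeasurable).2 h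

lemma integrable_sampleLoss : Integrable (sampleLoss pm M θ) (sampleLaw M pd pv) :=
  (integrable_finsetSum _ fun k _ => integrable_slicedLoss_eval h k).const_mul _

/-- Each pair `(x, w_k)` has law `p_d ⊗ p_v`, so every projection contributes the same expectation
and the population risk does not depend on `M`. -/
lemma integral_sampleLoss (hM : 0 < M) :
    ∫ z, sampleLoss pm M θ z ∂(sampleLaw M pd pv) = slicedObjective pm pd pv θ := by
  have h1 : ∀ k : Fin M, ∫ z, slicedLoss pm θ z.1 (z.2 k) ∂(sampleLaw M pd pv) =
      slicedObjective pm pd pv θ := fun k => by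
    rw [slicedObjective, ← integral_prod_symm _ h,
      ← (measurePreserving_sampleLaw (pd := pd) (pv := pv) k).map_eq, integral_map
        (measurePreserving_sampleLaw (pd := pd) (pv := pv) k).measurable.aemeasurable]
    rw [(measurePreserving_sampleLaw k).map_eq]
    exact h.aestronglyMeasurable
  have hM' : (M : ℝ) ≠ 0 := by positivity
  simp only [sampleLoss]
  rw [integral_const_mul, integral_finsetSum _ fun k _ => integrable_slicedLoss_eval h k]
  simp_rw [h1]
  simp [hM']

end Integrability

section Lipschitz

variable {Θ : Set (E d)} {L₁ L₂ : E D → ℝ}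

lemma abs_lossEntry_sub_le
    (h₁ : ∀ x, ∀ a ∈ Θ, ∀ b ∈ Θ,
      frobeniusNorm (scoreJacobian pm a x - scoreJacobian pm b x) ≤ L₁ x * ‖a - b‖)
    (h₂ : ∀ x, ∀ a ∈ Θ, ∀ b ∈ Θ,
      frobeniusNorm (outer (score pm a x) - outer (score pm b x)) ≤ L₂ x * ‖a - b‖)
    (x : E D) (i j : Fin D) {a b : E d} (ha : a ∈ Θ) (hb : b ∈ Θ) :
    |lossEntry pm x i j a - lossEntry pm x i j b| ≤ (|L₁ x| + |L₂ x|) * ‖a - b‖ := by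
  have e1 := (abs_apply_le_frobeniusNorm _ i j).trans (h₁ x a ha b hb)
  have e2 := (abs_apply_le_frobeniusNorm _ i j).trans (h₂ x a ha b hb)
  have e3 : L₁ x * ‖a - b‖ ≤ |L₁ x| * ‖a - b‖ := by gcongr; exact le_abs_self _
  have e4 : L₂ x * ‖a - b‖ ≤ |L₂ x| * ‖a - b‖ := by gcongr; exact le_abs_self _
  have e5 : lossEntry pm x i j a - lossEntry pm x i j b =
      (scoreJacobian pm a x - scoreJacobian pm b x) i j
        + 1 / 2 * (outer (score pm a x) - outer (score pm b x)) i j := by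
    simp only [lossEntry, secondPartial, partialProd, outer, Matrix.sub_apply, Matrix.of_apply]
    ring
  rw [e5]
  refine (abs_add_le _ _).trans ?_
  rw [abs_mul, abs_of_pos (by norm_num : (0 : ℝ) < 1 / 2)]
  have := abs_nonneg ((outer (score pm a x) - outer (score pm b x)) i j)
  linarith

lemma abs_sampleLoss_sub_le {Lx : E D → ℝ}
    (h : ∀ x i j, ∀ a ∈ Θ, ∀ b ∈ Θ,
      |lossEntry pm x i j a - lossEntry pm x i j b| ≤ Lx x * ‖a - b‖)
    (z : E D × (Fin M → E D)) {a b : E d} (ha : a ∈ Θ) (hb : b ∈ Θ) :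
    |sampleLoss pm M a z - sampleLoss pm M b z| ≤
      (D * D * (Lx z.1 * avgSq z.2)) * ‖a - b‖ := by
  rw [sampleLoss_eq_sum, sampleLoss_eq_sum, ← Finset.sum_sub_distrib]
  have e : ∀ ij ∈ (Finset.univ : Finset (Fin D × Fin D)),
      |avgOuter z.2 ij.1 ij.2 * lossEntry pm z.1 ij.1 ij.2 a
        - avgOuter z.2 ij.1 ij.2 * lossEntry pm z.1 ij.1 ij.2 b| ≤
      avgSq z.2 * (Lx z.1 * ‖a - b‖) := fun ij _ => by
    rw [← mul_sub, abs_mul]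
    exact mul_le_mul (abs_avgOuter_le _ _ _) (h _ _ _ a ha b hb) (abs_nonneg _)
      ((abs_nonneg _).trans (abs_avgOuter_le z.2 ij.1 ij.2))
  refine (Finset.abs_sum_le_sum_abs _ _).trans ((Finset.sum_le_sum e).trans_eq ?_)
  simp
  ring

end Lipschitz

section Smooth

variable {θ₀ : E d} {r : ℝ}
  (h₁ : ∀ x i j, ContDiffOn ℝ 2 (secondPartial pm x i j) (Metric.ball θ₀ r))
  (h₂ : ∀ x i j, ContDiffOn ℝ 2 (partialProd pm x i j) (Metric.ball θ₀ r))

include h₁ h₂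

lemma contDiffOn_lossEntry (x : E D) (i j : Fin D) :
    ContDiffOn ℝ 2 (lossEntry pm x i j) (Metric.ball θ₀ r) :=
  (h₁ x i j).add (contDiffOn_const.mul (h₂ x i j))

lemma gradTerm_eq {θ : E d} (hθ : θ ∈ Metric.ball θ₀ r) (x : E D) (i j : Fin D) :
    gradTerm pm θ i j x = dualToVec (fderiv ℝ (lossEntry pm x i j) θ) := by
  have e1 := hasFDerivAt_of_contDiffOn Metric.isOpen_ball (h₁ x i j) hθ
  have e2 := hasFDerivAt_of_contDiffOn Metric.isOpen_ball (h₂ x i j) hθ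
  have e3 : fderiv ℝ (lossEntry pm x i j) θ = fderiv ℝ (secondPartial pm x i j) θ
      + (1 / 2 : ℝ) • fderiv ℝ (partialProd pm x i j) θ := (e1.add (e2.const_mul _)).fderiv
  rw [e3, gradTerm, gradient_eq_dualToVec, gradient_eq_dualToVec, map_add, map_smul]

lemma fderiv_fderiv_lossEntry {θ : E d} (hθ : θ ∈ Metric.ball θ₀ r) (x : E D) (i j : Fin D) :
    fderiv ℝ (fderiv ℝ (lossEntry pm x i j)) θ = fderiv ℝ (fderiv ℝ (secondPartial pm x i j)) θ
      + (1 / 2 : ℝ) • fderiv ℝ (fderiv ℝ (partialProd pm x i j)) θ := by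
  have he : fderiv ℝ (lossEntry pm x i j) =ᶠ[𝓝 θ] fun θ =>
      fderiv ℝ (secondPartial pm x i j) θ + (1 / 2 : ℝ) • fderiv ℝ (partialProd pm x i j) θ := by
    filter_upwards [Metric.isOpen_ball.mem_nhds hθ] with θ' hθ'
    have e1 := hasFDerivAt_of_contDiffOn Metric.isOpen_ball (h₁ x i j) hθ'
    have e2 := hasFDerivAt_of_contDiffOn Metric.isOpen_ball (h₂ x i j) hθ'
    exact (e1.add (e2.const_mul _)).fderiv
  rw [he.fderiv_eq]
  have e1 := hasFDerivAt_fderiv_of_contDiffOn Metric.isOpen_ball (h₁ x i j) hθ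
  have e2 := hasFDerivAt_fderiv_of_contDiffOn Metric.isOpen_ball (h₂ x i j) hθ
  exact (e1.add (e2.const_smul (1 / 2 : ℝ))).fderiv

lemma contDiffOn_sampleLoss (z : E D × (Fin M → E D)) :
    ContDiffOn ℝ 2 (fun θ => sampleLoss pm M θ z) (Metric.ball θ₀ r) := by
  simp_rw [sampleLoss_eq_sum]
  exact ContDiffOn.sum fun ij _ => contDiffOn_const.mul (contDiffOn_lossEntry h₁ h₂ _ _ _)

lemma gradient_sampleLoss {θ : E d} (hθ : θ ∈ Metric.ball θ₀ r) (z : E D × (Fin M → E D))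
    (a : Fin d) : gradient (fun θ => sampleLoss pm M θ z) θ a =
      ∑ ij : Fin D × Fin D, gradTerm pm θ ij.1 ij.2 z.1 a * avgOuter z.2 ij.1 ij.2 := by
  simp_rw [sampleLoss_eq_sum]
  rw [gradient_apply, fderiv_sum_mul Metric.isOpen_ball
    (fun ij : Fin D × Fin D => contDiffOn_lossEntry h₁ h₂ z.1 ij.1 ij.2) hθ]
  rw [sum_apply]
  refine Finset.sum_congr rfl fun ij _ => ?_
  rw [gradTerm_eq h₁ h₂ hθ, dualToVec_apply, smul_apply, smul_eq_mul, mul_comm]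

lemma norm_fderiv_fderiv_sampleLoss_sub_le {K₁ K₂ : Fin D → Fin D → E D → ℝ}
    (hK₁ : ∀ i j x, ∀ a ∈ Metric.ball θ₀ r, ∀ b ∈ Metric.ball θ₀ r,
      frobeniusNorm (hess (secondPartial pm x i j) a - hess (secondPartial pm x i j) b)
        ≤ K₁ i j x * ‖a - b‖)
    (hK₂ : ∀ i j x, ∀ a ∈ Metric.ball θ₀ r, ∀ b ∈ Metric.ball θ₀ r,
      frobeniusNorm (hess (partialProd pm x i j) a - hess (partialProd pm x i j) b)
        ≤ K₂ i j x * ‖a - b‖)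
    (z : E D × (Fin M → E D)) {a b : E d} (ha : a ∈ Metric.ball θ₀ r)
    (hb : b ∈ Metric.ball θ₀ r) :
    ‖fderiv ℝ (fderiv ℝ fun θ => sampleLoss pm M θ z) a
      - fderiv ℝ (fderiv ℝ fun θ => sampleLoss pm M θ z) b‖ ≤
      ((∑ ij : Fin D × Fin D, d * (d * (|K₁ ij.1 ij.2 z.1| + |K₂ ij.1 ij.2 z.1|))) * avgSq z.2)
        * ‖a - b‖ := by
  simp_rw [sampleLoss_eq_sum]
  have hC := fun ij : Fin D × Fin D => contDiffOn_lossEntry h₁ h₂ z.1 ij.1 ij.2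
  rw [fderiv_fderiv_sum_mul Metric.isOpen_ball hC ha,
    fderiv_fderiv_sum_mul Metric.isOpen_ball hC hb,
    ← Finset.sum_sub_distrib, Finset.sum_mul, Finset.sum_mul]
  refine norm_sum_le_of_le _ fun ij _ => ?_
  rw [← smul_sub, norm_smul, fderiv_fderiv_lossEntry h₁ h₂ ha, fderiv_fderiv_lossEntry h₁ h₂ hb,
    add_sub_add_comm, ← smul_sub]
  have e1 := norm_fderiv_fderiv_sub_le Metric.isOpen_ball (h₁ z.1 ij.1 ij.2) ha hb
  have e2 := norm_fderiv_fderiv_sub_le Metric.isOpen_ball (h₂ z.1 ij.1 ij.2) ha hb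
  have f1 : frobeniusNorm (hess (secondPartial pm z.1 ij.1 ij.2) a
      - hess (secondPartial pm z.1 ij.1 ij.2) b) ≤ |K₁ ij.1 ij.2 z.1| * ‖a - b‖ :=
    (hK₁ _ _ _ a ha b hb).trans (mul_le_mul_of_nonneg_right (le_abs_self _) (norm_nonneg _))
  have f2 : frobeniusNorm (hess (partialProd pm z.1 ij.1 ij.2) a
      - hess (partialProd pm z.1 ij.1 ij.2) b) ≤ |K₂ ij.1 ij.2 z.1| * ‖a - b‖ :=
    (hK₂ _ _ _ a ha b hb).trans (mul_le_mul_of_nonneg_right (le_abs_self _) (norm_nonneg _))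
  have g1 := e1.trans (mul_le_mul_of_nonneg_left
    (mul_le_mul_of_nonneg_left f1 (Nat.cast_nonneg d)) (Nat.cast_nonneg d))
  have g2 := e2.trans (mul_le_mul_of_nonneg_left
    (mul_le_mul_of_nonneg_left f2 (Nat.cast_nonneg d)) (Nat.cast_nonneg d))
  have hn := norm_add_le (fderiv ℝ (fderiv ℝ (secondPartial pm z.1 ij.1 ij.2)) a
      - fderiv ℝ (fderiv ℝ (secondPartial pm z.1 ij.1 ij.2)) b)
    ((1 / 2 : ℝ) • (fderiv ℝ (fderiv ℝ (partialProd pm z.1 ij.1 ij.2)) a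
      - fderiv ℝ (fderiv ℝ (partialProd pm z.1 ij.1 ij.2)) b))
  rw [norm_smul (1 / 2 : ℝ), Real.norm_of_nonneg (by norm_num : (0 : ℝ) ≤ 1 / 2)] at hn
  have h0 := norm_nonneg (fderiv ℝ (fderiv ℝ (partialProd pm z.1 ij.1 ij.2)) a
      - fderiv ℝ (fderiv ℝ (partialProd pm z.1 ij.1 ij.2)) b)
  refine (mul_le_mul (abs_avgOuter_le z.2 ij.1 ij.2) (hn.trans (by linarith :
    _ ≤ d * (d * (|K₁ ij.1 ij.2 z.1| * ‖a - b‖)) + d * (d * (|K₂ ij.1 ij.2 z.1| * ‖a - b‖))))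
    (norm_nonneg _) ((abs_nonneg _).trans (abs_avgOuter_le z.2 ij.1 ij.2))).trans_eq ?_
  ring

end Smooth

end SampleLoss

/-! ### The second moment of the gradient -/

section Covariance

set_option maxSynthPendingDepth 3

variable {d D M : ℕ} {pm : E d → E D → ℝ} {pd : E D → ℝ}
  {pv : Measure (E D)} [IsProbabilityMeasure pv]

lemma measurable_lossEntry {θ : E d} (hs : Differentiable ℝ (score pm θ)) (i j : Fin D) :
    Measurable fun x => lossEntry pm x i j θ := by
  have h1 : Measurable fun x => scoreJacobian pm θ x i j := by
    -- Derivatives in `x` are measurable without being continuous.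
    have h : Measurable fun x => fderiv ℝ (score pm θ) x (basisVec i) :=
      measurable_fderiv_apply_const ℝ (score pm θ) (basisVec i)
    have h' : Measurable fun x => (fderiv ℝ (score pm θ) x (basisVec i)) j := by fun_prop
    exact h'
  have h2 : ∀ i, Measurable fun x => score pm θ x i := fun i => by
    have := hs.continuous.measurable
    fun_prop
  exact h1.add (((h2 i).mul (h2 j)).const_mul _)

/-- The Lipschitz constant in `θ` dominates the derivative at `θ₀`, so square integrability is
inherited from it. -/
lemma memLp_gradTerm {θ₀ : E d} {r : ℝ} (hr : 0 < r)
    (h₁ : ∀ x i j, ContDiffOn ℝ 2 (secondPartial pm x i j) (Metric.ball θ₀ r))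
    (h₂ : ∀ x i j, ContDiffOn ℝ 2 (partialProd pm x i j) (Metric.ball θ₀ r))
    (hs : ∀ θ ∈ Metric.ball θ₀ r, Differentiable ℝ (score pm θ))
    {Lx : E D → ℝ} (hL : MemLp Lx 2 (densityMeasure pd)) (hL0 : ∀ x, 0 ≤ Lx x)
    (hlip : ∀ x i j, ∀ a ∈ Metric.ball θ₀ r, ∀ b ∈ Metric.ball θ₀ r,
      |lossEntry pm x i j a - lossEntry pm x i j b| ≤ Lx x * ‖a - b‖) (i j : Fin D) :
    MemLp (gradTerm pm θ₀ i j) 2 (densityMeasure pd) := by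
  have hm : θ₀ ∈ Metric.ball θ₀ r := Metric.mem_ball_self hr
  have hn := Metric.isOpen_ball.mem_nhds hm
  have hd : ∀ x, HasFDerivAt (fun θ => lossEntry pm x i j θ)
      (fderiv ℝ (lossEntry pm x i j) θ₀) θ₀ := fun x =>
    hasFDerivAt_of_contDiffOn Metric.isOpen_ball (contDiffOn_lossEntry h₁ h₂ x i j) hm
  have hmeas : AEStronglyMeasurable (fun x => fderiv ℝ (lossEntry pm x i j) θ₀)
      (densityMeasure pd) := by
    refine aestronglyMeasurable_of_hasFDerivAt (g := fun θ x => lossEntry pm x i j θ) ?_ hd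
    filter_upwards [hn] with θ hθ using (measurable_lossEntry (hs θ hθ) i j).aestronglyMeasurable
  have h1 : MemLp (fun x => fderiv ℝ (lossEntry pm x i j) θ₀) 2 (densityMeasure pd) := by
    refine hL.of_le hmeas (Eventually.of_forall fun x => ?_)
    rw [Real.norm_of_nonneg (hL0 x)]
    refine (hd x).le_of_lip' (hL0 x) ?_
    filter_upwards [hn] with θ hθ using hlip x i j θ hθ θ₀ hm
  have h2 : gradTerm pm θ₀ i j = fun x => dualToVec (fderiv ℝ (lossEntry pm x i j) θ₀) :=
    funext fun x => gradTerm_eq h₁ h₂ hm x i j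
  rw [h2]
  exact dualToVec.comp_memLp' h1

lemma momentMatrix_gradient_sampleLoss [IsProbabilityMeasure (densityMeasure pd)] {θ₀ : E d}
    {r : ℝ} (hr : 0 < r)
    (h₁ : ∀ x i j, ContDiffOn ℝ 2 (secondPartial pm x i j) (Metric.ball θ₀ r))
    (h₂ : ∀ x i j, ContDiffOn ℝ 2 (partialProd pm x i j) (Metric.ball θ₀ r))
    (hg : ∀ i j, MemLp (gradTerm pm θ₀ i j) 2 (densityMeasure pd))
    (hv : MemLp (fun v : E D => ‖v‖ ^ 2) 2 pv) (hM : 0 < M) :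
    momentMatrix (sampleLaw M pd pv) (fun z => gradient (fun θ => sampleLoss pm M θ z) θ₀) =
      middleMatrix pm pd pv M θ₀ := by
  have hm : θ₀ ∈ Metric.ball θ₀ r := Metric.mem_ball_self hr
  ext a b
  have hgc : ∀ (a : Fin d) i j, MemLp (fun x => gradTerm pm θ₀ i j x a) 2 (densityMeasure pd) :=
    fun a i j => (EuclideanSpace.proj (𝕜 := ℝ) a).comp_memLp' (hg i j)
  have hint : ∀ ij pq : Fin D × Fin D, Integrable (fun z : E D × (Fin M → E D) =>
      (gradTerm pm θ₀ ij.1 ij.2 z.1 a * gradTerm pm θ₀ pq.1 pq.2 z.1 b)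
        * (avgOuter z.2 ij.1 ij.2 * avgOuter z.2 pq.1 pq.2)) (sampleLaw M pd pv) := fun ij pq =>
    ((hgc a ij.1 ij.2).integrable_mul (hgc b pq.1 pq.2)).mul_prod
      ((memLp_avgOuter hv ij.1 ij.2).integrable_mul (memLp_avgOuter hv pq.1 pq.2))
  have hexp : ∀ z : E D × (Fin M → E D),
      gradient (fun θ => sampleLoss pm M θ z) θ₀ a * gradient (fun θ => sampleLoss pm M θ z) θ₀ b =
      ∑ ij : Fin D × Fin D, ∑ pq : Fin D × Fin D,
        (gradTerm pm θ₀ ij.1 ij.2 z.1 a * gradTerm pm θ₀ pq.1 pq.2 z.1 b)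
        * (avgOuter z.2 ij.1 ij.2 * avgOuter z.2 pq.1 pq.2) := fun z => by
    rw [gradient_sampleLoss h₁ h₂ hm, gradient_sampleLoss h₁ h₂ hm, Finset.sum_mul_sum]
    refine Finset.sum_congr rfl fun ij _ => Finset.sum_congr rfl fun pq _ => by ring
  rw [momentMatrix, Matrix.of_apply]
  simp_rw [hexp]
  rw [integral_finsetSum _ fun ij _ => integrable_finsetSum _ fun pq _ => hint ij pq]
  simp only [middleMatrix, Matrix.sum_apply, Matrix.smul_apply, smul_eq_mul]
  rw [Fintype.sum_prod_type]
  refine Finset.sum_congr rfl fun i _ => Finset.sum_congr rfl fun j _ => ?_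
  rw [integral_finsetSum _ fun pq _ => hint (i, j) pq, Fintype.sum_prod_type]
  refine Finset.sum_congr rfl fun p _ => Finset.sum_congr rfl fun q _ => ?_
  rw [integral_prod_mul (fun x => gradTerm pm θ₀ i j x a * gradTerm pm θ₀ p q x b)
    (fun w : Fin M → E D => avgOuter w i j * avgOuter w p q),
    integral_avgOuter_mul_avgOuter hv hM, mul_comm]
  rfl

end Covariance

/-- Asymptotic normality of the sliced score matching estimator, for a general law of the
projection vectors. -/
theorem tendstoToNormal_sliced
    {d D : ℕ} {Θ : Set (E d)} {θ₀ : E d} {pm : E d → E D → ℝ} {pv : Measure (E D)}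
    [IsProbabilityMeasure pv]
    (h_pos : ∀ θ ∈ Θ, ∀ x, 0 < pm θ x) (h_norm : ∀ θ ∈ Θ, ∫ x, pm θ x = 1)
    (h_compact : IsCompact Θ) (h_interior : θ₀ ∈ interior Θ)
    (h_ident : ∀ θ ∈ Θ, θ ≠ θ₀ → pm θ ≠ pm θ₀)
    (h_diff_log : ∀ θ ∈ Θ, Differentiable ℝ (logDensity pm θ))
    (h_diff_score : ∀ θ ∈ Θ, Differentiable ℝ (score pm θ))
    (h_score_sq : ∀ θ ∈ Θ,
      Integrable (fun x => ‖score pm θ x‖ ^ 2) (densityMeasure (pm θ₀)))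
    (h_v_sq : Integrable (fun v : E D => ‖v‖ ^ 2) pv)
    (h_v_posDef : (secondMoment pv).PosDef)
    (h_v_four : Integrable (fun v : E D => frobeniusNorm (outer v) ^ 2) pv)
    (h_objective : ∀ θ ∈ Θ, Integrable (fun z : E D × E D => slicedLoss pm θ z.1 z.2)
      ((densityMeasure (pm θ₀)).prod pv))
    (h_lip₁ : ∃ L₁ : E D → ℝ, MemLp L₁ 2 (densityMeasure (pm θ₀)) ∧
      ∀ x, ∀ θ₁ ∈ Θ, ∀ θ₂ ∈ Θ,
        frobeniusNorm (scoreJacobian pm θ₁ x - scoreJacobian pm θ₂ x) ≤ L₁ x * ‖θ₁ - θ₂‖)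
    (h_lip₂ : ∃ L₂ : E D → ℝ, MemLp L₂ 2 (densityMeasure (pm θ₀)) ∧
      ∀ x, ∀ θ₁ ∈ Θ, ∀ θ₂ ∈ Θ,
        frobeniusNorm (outer (score pm θ₁ x) - outer (score pm θ₂ x)) ≤ L₂ x * ‖θ₁ - θ₂‖)
    (h_smooth : ∃ r > 0, ∀ i j : Fin D,
      (∀ x, ContDiffOn ℝ 2 (secondPartial pm x i j) (Metric.ball θ₀ r)) ∧
      (∀ x, ContDiffOn ℝ 2 (partialProd pm x i j) (Metric.ball θ₀ r)) ∧
      (∃ K : E D → ℝ, MemLp K 2 (densityMeasure (pm θ₀)) ∧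
        ∀ x, ∀ θ₁ ∈ Metric.ball θ₀ r, ∀ θ₂ ∈ Metric.ball θ₀ r,
          frobeniusNorm (hess (secondPartial pm x i j) θ₁ - hess (secondPartial pm x i j) θ₂)
            ≤ K x * ‖θ₁ - θ₂‖) ∧
      (∃ K : E D → ℝ, MemLp K 2 (densityMeasure (pm θ₀)) ∧
        ∀ x, ∀ θ₁ ∈ Metric.ball θ₀ r, ∀ θ₂ ∈ Metric.ball θ₀ r,
          frobeniusNorm (hess (partialProd pm x i j) θ₁ - hess (partialProd pm x i j) θ₂)
            ≤ K x * ‖θ₁ - θ₂‖))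
    (h_inv : IsUnit (hess (slicedObjective pm (pm θ₀) pv) θ₀).det)
    {Ω : Type*} [MeasurableSpace Ω] {P : Measure Ω} [IsProbabilityMeasure P]
    {M : ℕ} (hM : 0 < M) {x : ℕ → Ω → E D} {v : ℕ → Fin M → Ω → E D}
    (h_sample : IsSlicedSample P (pm θ₀) pv x v)
    {θhat : ℕ → Ω → E d} (h_est : IsSSMEstimator P pm Θ x v θhat) :
    TendstoToNormal P (fun N ω => √(N : ℝ) • (θhat N ω - θ₀))
      ((hess (slicedObjective pm (pm θ₀) pv) θ₀)⁻¹ * middleMatrix pm (pm θ₀) pv M θ₀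
        * (hess (slicedObjective pm (pm θ₀) pv) θ₀)⁻¹) := by
  have hθ₀ : θ₀ ∈ Θ := interior_subset h_interior
  have hμ := isProbabilityMeasure_densityMeasure (h_pos θ₀ hθ₀) (h_norm θ₀ hθ₀)
  obtain ⟨L₁, hL₁, hlip₁⟩ := h_lip₁
  obtain ⟨L₂, hL₂, hlip₂⟩ := h_lip₂
  obtain ⟨r₁, hr₁, hsm⟩ := h_smooth
  obtain ⟨r₂, hr₂, hball₂⟩ := Metric.mem_nhds_iff.1 (mem_interior_iff_mem_nhds.1 h_interior)
  -- The ball must lie in the region of smoothness and also inside `Θ`.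
  let r := min r₁ r₂
  have hr : 0 < r := lt_min hr₁ hr₂
  have hb₁ : Metric.ball θ₀ r ⊆ Metric.ball θ₀ r₁ := Metric.ball_subset_ball (min_le_left _ _)
  have hbΘ : Metric.ball θ₀ r ⊆ Θ := (Metric.ball_subset_ball (min_le_right _ _)).trans hball₂
  have hm : θ₀ ∈ Metric.ball θ₀ r := Metric.mem_ball_self hr
  have h₁ : ∀ x i j, ContDiffOn ℝ 2 (secondPartial pm x i j) (Metric.ball θ₀ r) :=
    fun x i j => ((hsm i j).1 x).mono hb₁
  have h₂ : ∀ x i j, ContDiffOn ℝ 2 (partialProd pm x i j) (Metric.ball θ₀ r) :=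
    fun x i j => ((hsm i j).2.1 x).mono hb₁
  choose K₁ hK₁ hKl₁ using fun i j => (hsm i j).2.2.1
  choose K₂ hK₂ hKl₂ using fun i j => (hsm i j).2.2.2
  let Lx : E D → ℝ := fun x => |L₁ x| + |L₂ x|
  have hLx : MemLp Lx 2 (densityMeasure (pm θ₀)) := hL₁.abs.add hL₂.abs
  have hv := memLp_norm_sq h_v_four
  have hlipΘ : ∀ x i j, ∀ a ∈ Θ, ∀ b ∈ Θ,
      |lossEntry pm x i j a - lossEntry pm x i j b| ≤ Lx x * ‖a - b‖ :=
    fun x i j a ha b hb => abs_lossEntry_sub_le hlip₁ hlip₂ x i j ha hb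
  have hlip : ∀ (z : E D × (Fin M → E D)), ∀ a ∈ Θ, ∀ b ∈ Θ,
      |sampleLoss pm M a z - sampleLoss pm M b z| ≤ (D * D * (Lx z.1 * avgSq z.2)) * ‖a - b‖ :=
    fun z a ha b hb => abs_sampleLoss_sub_le hlipΘ z ha hb
  have hintf : ∀ θ ∈ Θ, Integrable (sampleLoss pm M θ) (sampleLaw M (pm θ₀) pv) :=
    fun θ hθ => integrable_sampleLoss (h_objective θ hθ)
  have hreg : IsRegularLoss (sampleLaw M (pm θ₀) pv) (sampleLoss pm M) θ₀ r
      (fun z => D * D * (Lx z.1 * avgSq z.2))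
      (fun z => (∑ ij : Fin D × Fin D,
        d * (d * (|K₁ ij.1 ij.2 z.1| + |K₂ ij.1 ij.2 z.1|))) * avgSq z.2) := by
    refine ⟨hr, fun θ hθ => hintf θ (hbΘ hθ), ?_, fun z a ha b hb => hlip z a (hbΘ ha) b (hbΘ hb),
      contDiffOn_sampleLoss h₁ h₂, ?_, fun z θ hθ => ?_⟩
    -- The factors depend on independent variables, so second moments of each suffice; for `avgSq`
    -- this is the fourth-moment condition on `v`.
    · exact (memLp_two_mul_prod hLx (memLp_avgSq hv)).const_mul _
    · refine Integrable.mul_prod (f := fun x => ∑ ij : Fin D × Fin D,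
        d * (d * (|K₁ ij.1 ij.2 x| + |K₂ ij.1 ij.2 x|))) ?_
        ((memLp_avgSq hv).integrable (by norm_num))
      refine integrable_finsetSum _ fun ij _ => ?_
      exact ((((hK₁ ij.1 ij.2).integrable (by norm_num)).abs.add
        ((hK₂ ij.1 ij.2).integrable (by norm_num)).abs).const_mul _).const_mul _
    · exact norm_fderiv_fderiv_sampleLoss_sub_le h₁ h₂
        (fun i j x a ha b hb => hKl₁ i j x a (hb₁ ha) b (hb₁ hb))
        (fun i j x a ha b hb => hKl₂ i j x a (hb₁ ha) b (hb₁ hb)) z hθ hm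
  have hobj : ∀ θ ∈ Θ, ∫ z, sampleLoss pm M θ z ∂(sampleLaw M (pm θ₀) pv) =
      slicedObjective pm (pm θ₀) pv θ := fun θ hθ => integral_sampleLoss (h_objective θ hθ) hM
  have hhess : hess (fun θ => ∫ z, sampleLoss pm M θ z ∂(sampleLaw M (pm θ₀) pv)) θ₀ =
      hess (slicedObjective pm (pm θ₀) pv) θ₀ := by
    refine hess_congr ?_
    filter_upwards [Metric.isOpen_ball.mem_nhds hm] with θ hθ using hobj θ (hbΘ hθ)
  have hgrad : ∀ i j, MemLp (gradTerm pm θ₀ i j) 2 (densityMeasure (pm θ₀)) :=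
    memLp_gradTerm hr h₁ h₂ (fun θ hθ => h_diff_score θ (hbΘ hθ)) hLx
      (fun x => by positivity) fun x i j a ha b hb => hlipΘ x i j a (hbΘ ha) b (hbΘ hb)
  have hcov := momentMatrix_gradient_sampleLoss (pd := pm θ₀) hr h₁ h₂ hgrad hv hM
  rw [← hhess, ← hcov]
  refine tendstoToNormal_argmin h_compact hbΘ hreg hintf hlip (fun θ hθ hne => ?_)
    (by rwa [hhess]) h_sample.indep h_sample.law h_est.aemeasurable h_est.mem fun N hN => ?_
  · rw [hobj θ hθ, hobj θ₀ hθ₀]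
    by_contra! hle
    exact h_ident θ hθ hne (density_eq_of_slicedObjective_le (h_pos θ hθ) (h_pos θ₀ hθ₀)
      (h_diff_log θ hθ) (h_diff_log θ₀ hθ₀) (h_diff_score θ hθ) (h_diff_score θ₀ hθ₀)
      (h_norm θ hθ) (h_norm θ₀ hθ₀) (memLp_score (h_diff_score θ hθ) (h_score_sq θ hθ))
      (memLp_score (h_diff_score θ₀ hθ₀) (h_score_sq θ₀ hθ₀)) h_v_sq h_v_posDef
      (h_objective θ hθ) (h_objective θ₀ hθ₀) hle)
  · filter_upwards [h_est.isMinOn N hN] with ω hω θ hθ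
    have h3 := hω hθ
    simp only [Set.mem_ofPred_eq, empiricalObjective_eq] at h3
    exact le_of_mul_le_mul_left h3 (by positivity)

/-! ### Moments of Gaussian and Rademacher projections -/

section Moments

variable {D : ℕ}

/-- The reflection of `ℝᴰ` that changes the sign of the `k`-th coordinate. -/
def flip (k : Fin D) : E D ≃ₗᵢ[ℝ] E D :=
  LinearIsometryEquiv.piLpCongrRight 2 fun i =>
    if k = i then LinearIsometryEquiv.neg ℝ else LinearIsometryEquiv.refl ℝ ℝ

lemma flip_apply (k : Fin D) (v : E D) (i : Fin D) :
    flip k v i = (if k = i then -1 else 1) * v i := by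
  rw [flip, LinearIsometryEquiv.piLpCongrRight_apply]
  split_ifs with h <;> simp [h]

variable {pv : Measure (E D)}

lemma integral_flip (hf : ∀ k : Fin D, pv.map (flip k) = pv) (k : Fin D) {g : E D → ℝ}
    (hg : Measurable g) : ∫ v, g (flip k v) ∂pv = ∫ v, g v ∂pv := by
  conv_rhs => rw [← hf k]
  rw [integral_map (flip k).continuous.measurable.aemeasurable hg.aestronglyMeasurable]

lemma secondMoment_flip (hf : ∀ k : Fin D, pv.map (flip k) = pv) (k i j : Fin D) :
    (if k = i then -1 else 1) * (if k = j then -1 else 1) * secondMoment pv i j =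
      secondMoment pv i j := by
  have h := integral_flip hf k (g := fun v => v i * v j) (by fun_prop)
  rw [secondMoment, Matrix.of_apply, ← integral_const_mul]
  rw [← h]
  refine integral_congr_ae (Eventually.of_forall fun v => ?_)
  simp only [flip_apply]
  ring

lemma fourthMoment_flip (hf : ∀ k : Fin D, pv.map (flip k) = pv) (k i j p q : Fin D) :
    (if k = i then -1 else 1) * (if k = j then -1 else 1) * (if k = p then -1 else 1)
      * (if k = q then -1 else 1) * fourthMoment pv i j p q = fourthMoment pv i j p q := by
  have h := integral_flip hf k (g := fun v => v i * v j * v p * v q) (by fun_prop)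
  rw [fourthMoment, ← integral_const_mul]
  rw [← h]
  refine integral_congr_ae (Eventually.of_forall fun v => ?_)
  simp only [flip_apply]
  ring

lemma secondMoment_eq_one (hf : ∀ k : Fin D, pv.map (flip k) = pv)
    (h2 : ∀ i : Fin D, ∫ v : E D, v i * v i ∂pv = 1) : secondMoment pv = 1 := by
  ext i j
  rcases eq_or_ne i j with rfl | h
  · simpa [secondMoment] using h2 i
  · have := secondMoment_flip hf i i j
    rw [Matrix.one_apply_ne h]
    simp only [if_pos, if_neg h] at this
    linarith

/-- The fourth moments of a reflection invariant law with unit second moments whose squared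
coordinates are uncorrelated. -/
lemma fourthMoment_eq (hf : ∀ k : Fin D, pv.map (flip k) = pv) {κ : ℝ}
    (h22 : ∀ i j : Fin D, i ≠ j → fourthMoment pv i i j j = 1)
    (h4 : ∀ i : Fin D, fourthMoment pv i i i i = 3 + κ) (i j p q : Fin D) :
    fourthMoment pv i j p q =
      (1 : Matrix (Fin D) (Fin D) ℝ) i j * (1 : Matrix (Fin D) (Fin D) ℝ) p q
      + (1 : Matrix (Fin D) (Fin D) ℝ) i p * (1 : Matrix (Fin D) (Fin D) ℝ) j q
      + (1 : Matrix (Fin D) (Fin D) ℝ) i q * (1 : Matrix (Fin D) (Fin D) ℝ) j p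
      + κ * ((1 : Matrix (Fin D) (Fin D) ℝ) i j * (1 : Matrix (Fin D) (Fin D) ℝ) i p
        * (1 : Matrix (Fin D) (Fin D) ℝ) i q) := by
  have hc1 : ∀ i j p q : Fin D, fourthMoment pv i j p q = fourthMoment pv i p j q := by
    intro i j p q
    simp only [fourthMoment]
    congr 1
    ext v
    ring
  have hc2 : ∀ i j p q : Fin D, fourthMoment pv i j p q = fourthMoment pv i j q p := by
    intro i j p q
    simp only [fourthMoment]
    congr 1
    ext v
    ring
  -- Flipping a coordinate that occurs an odd number of times changes the sign of the moment, which
  -- must then vanish. In every unpaired case below, one of the four positions holds an index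
  -- occurring exactly once.
  have fi := fourthMoment_flip hf i i j p q
  have fj := fourthMoment_flip hf j i j p q
  have fp := fourthMoment_flip hf p i j p q
  have fq := fourthMoment_flip hf q i j p q
  simp only [Matrix.one_apply]
  rcases eq_or_ne i j with rfl | hij
  · rcases eq_or_ne p q with rfl | hpq
    · rcases eq_or_ne i p with rfl | hip
      · simp [h4]; ring
      · simp [h22 i p hip, hip]
    · rcases eq_or_ne i p with rfl | hip
      · simp [hpq, hpq.symm] at fq ⊢
        linarith
      · simp [hpq, hip.symm] at fp
        simp [hpq, hip]
        linarith
  · rcases eq_or_ne i p with rfl | hip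
    · rcases eq_or_ne j q with rfl | hjq
      · simp [hij, hc1 i j i j, h22 i j hij]
      · simp [hij.symm, hjq] at fj
        simp [hij.symm, hij, hjq]
        linarith
    · rcases eq_or_ne i q with rfl | hiq
      · rcases eq_or_ne j p with rfl | hjp
        · simp [hij, hc2 i j j i, hc1 i j i j, h22 i j hij]
        · simp [hij.symm, hjp] at fj
          simp [hij, hip, hjp]
          linarith
      · simp [hij, hip, hiq] at fi
        simp [hij, hip, hiq]
        linarith

lemma map_flip_stdGaussian (k : Fin D) :
    (stdGaussian (E D)).map (flip k) = stdGaussian (E D) := stdGaussian_map (flip k)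

lemma integral_comp_coord_stdGaussian (i : Fin D) {g : ℝ → ℝ} (hg : Measurable g) :
    ∫ v : E D, g (v i) ∂(stdGaussian (E D)) = ∫ y, g y ∂(gaussianReal 0 1) := by
  have h := measurePreserving_eval_multivariateGaussian (ι := Fin D) (μ := 0)
    (S := 1) Matrix.PosSemidef.one (i := i)
  rw [multivariateGaussian_zero_one] at h
  simp only [PiLp.zero_apply, Matrix.one_apply_eq, Real.toNNReal_one] at h
  rw [← h.map_eq, integral_map h.measurable.aemeasurable hg.aestronglyMeasurable]

lemma integral_sq_gaussianReal : ∫ y, y ^ 2 ∂(gaussianReal 0 1) = 1 := by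
  have h := variance_fun_id_gaussianReal (μ := 0) (v := 1)
  rw [variance_of_integral_eq_zero (by fun_prop) (by simp)] at h
  simpa using h

/-- Read off as the fourth derivative at `0` of the moment generating function `exp (t² / 2)`; each
derivative is a polynomial times this exponential. -/
lemma integral_pow_four_gaussianReal : ∫ y, y ^ 4 ∂(gaussianReal 0 1) = 3 := by
  have h0 : (0 : ℝ) ∈ interior (integrableExpSet id (gaussianReal 0 1)) := by simp
  have h := iteratedDeriv_mgf_zero (X := id) h0 4
  have hm : mgf id (gaussianReal 0 1) = fun t => Real.exp (t ^ 2 / 2) := by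
    rw [mgf_id_gaussianReal]
    simp
  simp only [hm, Pi.pow_apply, id] at h
  rw [← h]
  have he : ∀ t : ℝ, HasDerivAt (fun t : ℝ => Real.exp (t ^ 2 / 2)) (Real.exp (t ^ 2 / 2) * t) t :=
    fun t => by
      have : HasDerivAt (fun t : ℝ => t ^ 2 / 2) t t := by
        convert! (hasDerivAt_pow 2 t).div_const 2 using 1
        simp
      exact this.exp
  have e1 : deriv (fun t : ℝ => Real.exp (t ^ 2 / 2)) = fun t => t * Real.exp (t ^ 2 / 2) := by
    funext t
    rw [(he t).deriv, mul_comm]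
  have e2 : deriv (fun t : ℝ => t * Real.exp (t ^ 2 / 2)) =
      fun t => (1 + t ^ 2) * Real.exp (t ^ 2 / 2) := by
    funext t
    refine (((hasDerivAt_id t).fun_mul (he t)).deriv).trans ?_
    simp only [id]
    ring
  have e3 : deriv (fun t : ℝ => (1 + t ^ 2) * Real.exp (t ^ 2 / 2)) =
      fun t => (3 * t + t ^ 3) * Real.exp (t ^ 2 / 2) := by
    funext t
    refine ((((hasDerivAt_pow 2 t).const_add 1).fun_mul (he t)).deriv).trans ?_
    simp only [Nat.cast_ofNat]
    ring
  have e4 : deriv (fun t : ℝ => (3 * t + t ^ 3) * Real.exp (t ^ 2 / 2)) =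
      fun t => (3 + 6 * t ^ 2 + t ^ 4) * Real.exp (t ^ 2 / 2) := by
    funext t
    refine (((((hasDerivAt_id t).const_mul 3).fun_add (hasDerivAt_pow 3 t)).fun_mul
      (he t)).deriv).trans ?_
    simp only [Nat.cast_ofNat, id]
    ring
  rw [iteratedDeriv_succ', e1, iteratedDeriv_succ', e2, iteratedDeriv_succ', e3,
    iteratedDeriv_succ', e4, iteratedDeriv_zero]
  simp

lemma fourthMoment_stdGaussian_self (i : Fin D) :
    fourthMoment (stdGaussian (E D)) i i i i = 3 + 0 := by
  rw [fourthMoment, add_zero, ← integral_pow_four_gaussianReal,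
    ← integral_comp_coord_stdGaussian i (g := fun y => y ^ 4) (by fun_prop)]
  congr 1
  ext v
  ring

lemma integral_sq_coord_stdGaussian (i : Fin D) :
    ∫ v : E D, v i * v i ∂(stdGaussian (E D)) = 1 := by
  rw [← integral_sq_gaussianReal,
    ← integral_comp_coord_stdGaussian i (g := fun y => y ^ 2) (by fun_prop)]
  congr 1
  ext v
  ring

lemma fourthMoment_stdGaussian_of_ne {i j : Fin D} (hij : i ≠ j) :
    fourthMoment (stdGaussian (E D)) i i j j = 1 := by
  have hi : iIndepFun (fun (k : Fin D) (y : Fin D → ℝ) => y k)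
      (Measure.pi fun _ : Fin D => gaussianReal 0 1) :=
    iIndepFun_pi (X := fun _ y => y) fun _ => aemeasurable_id
  have h2 := (hi.indepFun hij).comp (φ := fun y : ℝ => y * y) (ψ := fun y : ℝ => y * y)
    (by fun_prop) (by fun_prop)
  have h3 := h2.integral_fun_mul_eq_mul_integral (by fun_prop) (by fun_prop)
  have hmap : ∀ g : E D → ℝ, Measurable g → ∫ v, g v ∂(stdGaussian (E D)) =
      ∫ y, g (WithLp.toLp 2 y) ∂(Measure.pi fun _ : Fin D => gaussianReal 0 1) := fun g hg => by
    rw [← map_pi_eq_stdGaussian, integral_map (by fun_prop) hg.aestronglyMeasurable]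
  have e : ∀ i : Fin D, ∫ y : Fin D → ℝ, y i * y i ∂(Measure.pi fun _ => gaussianReal 0 1) = 1 :=
    fun i => by
      rw [← integral_sq_coord_stdGaussian i, hmap _ (by fun_prop)]
  rw [fourthMoment, hmap _ (by fun_prop)]
  simp only [Function.comp_def] at h3
  rw [e, e, mul_one] at h3
  rw [← h3]
  congr 1
  ext y
  ring

/-- The uniform distribution on an infinite set is the zero measure by convention, so total mass one
already forces the support to be finite. -/
lemma finite_rademacher_support [IsProbabilityMeasure (rademacher D)] :
    {v : E D | ∀ i, v i = 1 ∨ v i = -1}.Finite := by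
  refine finite_of_uniformOn_ne_zero (t := Set.univ) ?_
  have : rademacher D Set.univ = 1 := measure_univ
  rw [rademacher] at this
  rw [this]
  exact one_ne_zero

lemma ae_rademacher [IsProbabilityMeasure (rademacher D)] :
    ∀ᵐ v ∂(rademacher D), ∀ i, v i = 1 ∨ v i = -1 :=
  ae_cond_mem finite_rademacher_support.measurableSet

lemma map_flip_rademacher [IsProbabilityMeasure (rademacher D)] (k : Fin D) :
    (rademacher D).map (flip k) = rademacher D := by
  have hfin := finite_rademacher_support (D := D)
  set s := {v : E D | ∀ i, v i = 1 ∨ v i = -1} with hs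
  have hmem : ∀ v, flip k v ∈ s ↔ v ∈ s := fun v => by
    simp only [hs, Set.mem_ofPred_eq, flip_apply]
    refine forall_congr' fun i => ?_
    split_ifs
    · rw [neg_one_mul, neg_inj, neg_eq_iff_eq_neg, or_comm]
    · rw [one_mul]
  ext t ht
  rw [Measure.map_apply (flip k).continuous.measurable ht]
  simp only [rademacher, uniformOn]
  rw [cond_apply hfin.measurableSet, cond_apply hfin.measurableSet]
  congr 1
  -- The flip permutes the support, and counting measure is invariant under injections.
  have e : s ∩ flip k ⁻¹' t = (flip k).symm '' (s ∩ t) := by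
    ext v
    constructor
    · rintro ⟨h1, h2⟩
      exact ⟨flip k v, ⟨(hmem v).2 h1, h2⟩, by simp⟩
    · rintro ⟨w, ⟨h1, h2⟩, rfl⟩
      exact ⟨(hmem _).1 (by simpa using h1), by simpa using h2⟩
  rw [e, Measure.count_injective_image (flip k).symm.injective]

lemma integral_sq_coord_rademacher [IsProbabilityMeasure (rademacher D)] (i : Fin D) :
    ∫ v : E D, v i * v i ∂(rademacher D) = 1 := by
  have : ∀ᵐ v ∂(rademacher D), v i * v i = 1 := by
    filter_upwards [ae_rademacher] with v hv
    rcases hv i with h | h <;> simp [h]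
  rw [integral_congr_ae this]
  simp

lemma fourthMoment_rademacher [IsProbabilityMeasure (rademacher D)] (i j : Fin D) :
    fourthMoment (rademacher D) i i j j = 1 := by
  have : ∀ᵐ v ∂(rademacher D), v i * v i * v j * v j = 1 := by
    filter_upwards [ae_rademacher] with v hv
    rcases hv i with h | h <;> rcases hv j with h' | h' <;> simp [h, h']
  rw [fourthMoment, integral_congr_ae this]
  simp

end Moments

/-! ### The covariance for isotropic projections -/

section Isotropic

variable {d D M : ℕ} {pm : E d → E D → ℝ} {Θ : Set (E d)} {θ θ₀ : E d}

/-- With isotropic projections, the sliced objective is the score matching objective. -/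
lemma slicedObjective_eq_scoreMatchingObjective {pd : E D → ℝ}
    [IsProbabilityMeasure (densityMeasure pd)] {pv : Measure (E D)} [IsProbabilityMeasure pv]
    (hv : MemLp (fun v : E D => ‖v‖ ^ 2) 2 pv) (h1 : secondMoment pv = 1)
    (h : Integrable (fun z : E D × E D => slicedLoss pm θ z.1 z.2)
      ((densityMeasure pd).prod pv)) :
    slicedObjective pm pd pv θ = scoreMatchingObjective pm pd θ := by
  rw [slicedObjective, integral_integral_swap (f := fun v x => slicedLoss pm θ x v) h.swap,
    scoreMatchingObjective]
  refine integral_congr_ae (Eventually.of_forall fun x => ?_)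
  have hint : ∀ i j : Fin D, Integrable (fun v : E D => v i * v j * lossEntry pm x i j θ) pv :=
    fun i j => ((memLp_coord_mul_coord hv i j).integrable (by norm_num)).mul_const _
  simp only [slicedLoss_eq_sum]
  rw [integral_finsetSum _ fun i _ => integrable_finsetSum _ fun j _ => hint i j]
  have e : ∀ i : Fin D, ∫ v : E D, ∑ j, v i * v j * lossEntry pm x i j θ ∂pv =
      scoreJacobian pm θ x i i + 1 / 2 * (score pm θ x i) ^ 2 := fun i => by
    rw [integral_finsetSum _ fun j _ => hint i j]
    have e' : ∀ j : Fin D, ∫ v : E D, v i * v j * lossEntry pm x i j θ ∂pv =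
        (1 : Matrix (Fin D) (Fin D) ℝ) i j * lossEntry pm x i j θ := fun j => by
      rw [integral_mul_const, ← h1]
      rfl
    simp_rw [e', Matrix.one_apply]
    simp [lossEntry, secondPartial, partialProd, sq]
  simp_rw [e]
  rw [Finset.sum_add_distrib, ← Finset.mul_sum, EuclideanSpace.real_norm_sq_eq]
  rfl

/-- Differentiability of the gradient suffices for symmetry of second derivatives; continuity of the
Hessian in `x` plays no role. -/
lemma scoreJacobian_symm (hl : Differentiable ℝ (logDensity pm θ))
    (hs : Differentiable ℝ (score pm θ)) (x : E D) (i j : Fin D) :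
    scoreJacobian pm θ x i j = scoreJacobian pm θ x j i := by
  have h := second_derivative_symmetric (f := logDensity pm θ)
    (f' := fun y => innerSL ℝ (score pm θ y)) (x := x)
    (fun y => (hasGradientAt_logDensity hl y).hasFDerivAt)
    ((innerSL ℝ).hasFDerivAt.comp x (hs x).hasFDerivAt) (basisVec i) (basisVec j)
  have e : ∀ i j, inner ℝ (fderiv ℝ (score pm θ) x (basisVec i)) (basisVec j) =
      scoreJacobian pm θ x i j := fun i j => by
    rw [PiLp.inner_apply]
    simp [scoreJacobian, hess]
    rfl
  rw [← e, ← e]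
  exact h

/-- Makes two of the three pairings in Isserlis' formula contribute the same matrices. The symmetry
in `x` must hold for all parameters near `θ₀`, since it is differentiated in `θ`. -/
lemma gradTerm_symm (hl : ∀ θ ∈ Θ, Differentiable ℝ (logDensity pm θ))
    (hs : ∀ θ ∈ Θ, Differentiable ℝ (score pm θ)) (hθ : θ₀ ∈ interior Θ) (i j : Fin D) :
    gradTerm pm θ₀ i j = gradTerm pm θ₀ j i := by
  funext x
  have h1 : secondPartial pm x i j =ᶠ[𝓝 θ₀] secondPartial pm x j i := by
    filter_upwards [mem_interior_iff_mem_nhds.1 hθ] with θ h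
    exact scoreJacobian_symm (hl θ h) (hs θ h) x i j
  have h2 : partialProd pm x i j = partialProd pm x j i := funext fun θ => mul_comm _ _
  simp only [gradTerm, gradient, h2, h1.fderiv_eq]

/-- The pairing `ij|pq` gets the weight `(1 - c) + c = 1`, so it is independent of `c = 1/M`. The
pairings `ip|jq` and `iq|jp` each get weight `c` and agree by `hF`. -/
lemma sum_isserlis_smul {V : Type*} [AddCommGroup V] [Module ℝ V]
    {F : Fin D → Fin D → Fin D → Fin D → V} (hF : ∀ i j, F i j j i = F i j i j) (c κ : ℝ) :
    ∑ i, ∑ j, ∑ p, ∑ q, ((1 - c) * ((1 : Matrix (Fin D) (Fin D) ℝ) i j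
        * (1 : Matrix (Fin D) (Fin D) ℝ) p q)
      + c * ((1 : Matrix (Fin D) (Fin D) ℝ) i j * (1 : Matrix (Fin D) (Fin D) ℝ) p q
        + (1 : Matrix (Fin D) (Fin D) ℝ) i p * (1 : Matrix (Fin D) (Fin D) ℝ) j q
        + (1 : Matrix (Fin D) (Fin D) ℝ) i q * (1 : Matrix (Fin D) (Fin D) ℝ) j p
        + κ * ((1 : Matrix (Fin D) (Fin D) ℝ) i j * (1 : Matrix (Fin D) (Fin D) ℝ) i p
          * (1 : Matrix (Fin D) (Fin D) ℝ) i q))) • F i j p q =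
      ∑ i, ∑ j, F i i j j + (2 * c) • (∑ i, ∑ j, F i j i j) + (κ * c) • ∑ i, F i i i i := by
  have h : ∀ i j p q : Fin D, ((1 - c) * ((1 : Matrix (Fin D) (Fin D) ℝ) i j
        * (1 : Matrix (Fin D) (Fin D) ℝ) p q)
      + c * ((1 : Matrix (Fin D) (Fin D) ℝ) i j * (1 : Matrix (Fin D) (Fin D) ℝ) p q
        + (1 : Matrix (Fin D) (Fin D) ℝ) i p * (1 : Matrix (Fin D) (Fin D) ℝ) j q
        + (1 : Matrix (Fin D) (Fin D) ℝ) i q * (1 : Matrix (Fin D) (Fin D) ℝ) j p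
        + κ * ((1 : Matrix (Fin D) (Fin D) ℝ) i j * (1 : Matrix (Fin D) (Fin D) ℝ) i p
          * (1 : Matrix (Fin D) (Fin D) ℝ) i q))) • F i j p q =
      (if i = j then if p = q then F i j p q else 0 else 0)
        + c • (if i = p then if j = q then F i j p q else 0 else 0)
        + c • (if j = p then if i = q then F i j p q else 0 else 0)
        + (κ * c) • (if i = j then if i = p then if i = q then F i j p q else 0 else 0 else 0) :=
    fun i j p q => by
      simp only [Matrix.one_apply]
      split_ifs <;> simp <;> module
  simp_rw [h, Finset.sum_add_distrib, ← Finset.smul_sum]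
  have h1 : ∑ i, ∑ j, ∑ p, ∑ q, (if i = j then if p = q then F i j p q else 0 else 0) =
      ∑ i, ∑ j, F i i j j := by
    refine Finset.sum_congr rfl fun i _ => ?_
    simp [Finset.sum_ite_irrel]
  have h2 : ∑ i, ∑ j, ∑ p, ∑ q, (if i = p then if j = q then F i j p q else 0 else 0) =
      ∑ i, ∑ j, F i j i j := by
    simp [Finset.sum_ite_irrel]
  have h3 : ∑ i, ∑ j, ∑ p, ∑ q, (if j = p then if i = q then F i j p q else 0 else 0) =
      ∑ i, ∑ j, F i j i j := by
    simp [Finset.sum_ite_irrel, hF]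
  have h4 : ∑ i, ∑ j, ∑ p, ∑ q, (if i = j then if i = p then if i = q then F i j p q
      else 0 else 0 else 0) = ∑ i, F i i i i := by
    simp [Finset.sum_ite_irrel]
  rw [h1, h2, h3, h4]
  module

/-- The middle matrix for reflection invariant isotropic projections. -/
lemma middleMatrix_eq {pd : E D → ℝ} {pv : Measure (E D)} (h1 : secondMoment pv = 1) {κ : ℝ}
    (h4 : ∀ i j p q : Fin D, fourthMoment pv i j p q =
      (1 : Matrix (Fin D) (Fin D) ℝ) i j * (1 : Matrix (Fin D) (Fin D) ℝ) p q
      + (1 : Matrix (Fin D) (Fin D) ℝ) i p * (1 : Matrix (Fin D) (Fin D) ℝ) j q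
      + (1 : Matrix (Fin D) (Fin D) ℝ) i q * (1 : Matrix (Fin D) (Fin D) ℝ) j p
      + κ * ((1 : Matrix (Fin D) (Fin D) ℝ) i j * (1 : Matrix (Fin D) (Fin D) ℝ) i p
        * (1 : Matrix (Fin D) (Fin D) ℝ) i q))
    (hg : ∀ i j : Fin D, gradTerm pm θ₀ i j = gradTerm pm θ₀ j i) :
    middleMatrix pm pd pv M θ₀ = (∑ i, ∑ j, matV pm pd θ₀ i j)
      + (2 / (M : ℝ)) • (∑ i, ∑ j ∈ Finset.univ.erase i, matW pm pd θ₀ i j)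
      + ((2 + κ) / (M : ℝ)) • (∑ i, matV pm pd θ₀ i i) := by
  have hF : ∀ i j : Fin D, frakV pm pd θ₀ i j j i = frakV pm pd θ₀ i j i j := fun i j => by
    rw [frakV, hg j i]
    rfl
  have hW : ∑ i, ∑ j, frakV pm pd θ₀ i j i j = (∑ i, matV pm pd θ₀ i i)
      + ∑ i, ∑ j ∈ Finset.univ.erase i, matW pm pd θ₀ i j := by
    rw [← Finset.sum_add_distrib]
    refine Finset.sum_congr rfl fun i _ => ?_
    exact (Finset.add_sum_erase Finset.univ (fun j => frakV pm pd θ₀ i j i j)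
      (Finset.mem_univ i)).symm
  rw [middleMatrix, h1]
  simp_rw [h4]
  rw [sum_isserlis_smul hF, hW]
  simp only [matV]
  module

end Isotropic

end

end SlicedScoreMatching

theorem theorem3
    {d D : ℕ} (Θ : Set (E d)) (θstar : E d)
    -- model densities, data density, law of the projection vectors
    (pm : E d → E D → ℝ) (pd : E D → ℝ) (pv : Measure (E D)) [IsProbabilityMeasure pv]
    -- the model densities are positive and normalized
    (h_pos : ∀ θ ∈ Θ, ∀ x, 0 < pm θ x)
    (h_norm : ∀ θ ∈ Θ, ∫ x, pm θ x = 1)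
    -- well-specified and identifiable, with true parameter in the interior of the compact `Θ`
    (h_compact : IsCompact Θ)
    (h_interior : θstar ∈ interior Θ)
    (h_well : ∀ x, pd x = pm θstar x)
    (h_ident : ∀ θ ∈ Θ, θ ≠ θstar → pm θ ≠ pm θstar)
    -- regularity of the scores (the data score is the model score at `θstar`)
    (h_diff_log : ∀ θ ∈ Θ, Differentiable ℝ (logDensity pm θ))
    (h_diff_score : ∀ θ ∈ Θ, Differentiable ℝ (score pm θ))
    (h_score_sq : ∀ θ ∈ Θ, Integrable (fun x => ‖score pm θ x‖ ^ 2) (densityMeasure pd))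
    -- regularity of the projection vectors
    (h_v_sq : Integrable (fun v : E D => ‖v‖ ^ 2) pv)
    (h_v_posDef : (secondMoment pv).PosDef)
    (h_v_four : Integrable (fun v : E D => frobeniusNorm (outer v) ^ 2) pv)
    -- boundary conditions
    (h_boundary : ∀ θ ∈ Θ,
      Tendsto (fun x => pd x • score pm θ x) (cocompact (E D)) (𝓝 0))
    -- the population objective is well defined
    (h_objective : ∀ θ ∈ Θ, Integrable (fun z : E D × E D => slicedLoss pm θ z.1 z.2)
      ((densityMeasure pd).prod pv))
    -- Lipschitz continuity in `θ`
    (h_lip₁ : ∃ L₁ : E D → ℝ, MemLp L₁ 2 (densityMeasure pd) ∧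
      ∀ x, ∀ θ₁ ∈ Θ, ∀ θ₂ ∈ Θ,
        frobeniusNorm (scoreJacobian pm θ₁ x - scoreJacobian pm θ₂ x) ≤ L₁ x * ‖θ₁ - θ₂‖)
    (h_lip₂ : ∃ L₂ : E D → ℝ, MemLp L₂ 2 (densityMeasure pd) ∧
      ∀ x, ∀ θ₁ ∈ Θ, ∀ θ₂ ∈ Θ,
        frobeniusNorm (outer (score pm θ₁ x) - outer (score pm θ₂ x)) ≤ L₂ x * ‖θ₁ - θ₂‖)
    -- Lipschitz smoothness of the second `θ`-derivatives near `θstar`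
    (h_smooth : ∃ r > 0, ∀ i j : Fin D,
      (∀ x, ContDiffOn ℝ 2 (secondPartial pm x i j) (Metric.ball θstar r)) ∧
      (∀ x, ContDiffOn ℝ 2 (partialProd pm x i j) (Metric.ball θstar r)) ∧
      (∃ K : E D → ℝ, MemLp K 2 (densityMeasure pd) ∧
        ∀ x, ∀ θ₁ ∈ Metric.ball θstar r, ∀ θ₂ ∈ Metric.ball θstar r,
          frobeniusNorm (hess (secondPartial pm x i j) θ₁ - hess (secondPartial pm x i j) θ₂)
            ≤ K x * ‖θ₁ - θ₂‖) ∧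
      (∃ K : E D → ℝ, MemLp K 2 (densityMeasure pd) ∧
        ∀ x, ∀ θ₁ ∈ Metric.ball θstar r, ∀ θ₂ ∈ Metric.ball θstar r,
          frobeniusNorm (hess (partialProd pm x i j) θ₁ - hess (partialProd pm x i j) θ₂)
            ≤ K x * ‖θ₁ - θ₂‖))
    -- the Hessian of the population objective at `θstar` is invertible
    (h_inv : IsUnit (hess (slicedObjective pm pd pv) θstar).det)
    -- sample and estimator
    {Ω : Type*} [MeasurableSpace Ω] (P : Measure Ω) [IsProbabilityMeasure P]
    (M : ℕ) (hM : 0 < M) (x : ℕ → Ω → E D) (v : ℕ → Fin M → Ω → E D)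
    (h_sample : IsSlicedSample P pd pv x v)
    (θhat : ℕ → Ω → E d) (h_est : IsSSMEstimator P pm Θ x v θhat) :
    TendstoToNormal P (fun N ω => √(N : ℝ) • (θhat N ω - θstar))
      ((hess (slicedObjective pm pd pv) θstar)⁻¹ * middleMatrix pm pd pv M θstar
        * (hess (slicedObjective pm pd pv) θstar)⁻¹) ∧
    (pv = stdGaussian (E D) →
      TendstoToNormal P (fun N ω => √(N : ℝ) • (θhat N ω - θstar))
        ((hess (scoreMatchingObjective pm pd) θstar)⁻¹
          * ((∑ i, ∑ j, matV pm pd θstar i j)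
            + (2 / (M : ℝ)) • (∑ i, matV pm pd θstar i i)
            + (2 / (M : ℝ)) • (∑ i, ∑ j ∈ Finset.univ.erase i, matW pm pd θstar i j))
          * (hess (scoreMatchingObjective pm pd) θstar)⁻¹)) ∧
    (pv = rademacher D →
      TendstoToNormal P (fun N ω => √(N : ℝ) • (θhat N ω - θstar))
        ((hess (scoreMatchingObjective pm pd) θstar)⁻¹
          * ((∑ i, ∑ j, matV pm pd θstar i j)
            + (2 / (M : ℝ)) • (∑ i, ∑ j ∈ Finset.univ.erase i, matW pm pd θstar i j))
          * (hess (scoreMatchingObjective pm pd) θstar)⁻¹)) := by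
  obtain rfl : pd = pm θstar := funext h_well
  have hΘ := mem_interior_iff_mem_nhds.1 h_interior
  have hθ : θstar ∈ Θ := interior_subset h_interior
  have hμ := isProbabilityMeasure_densityMeasure (h_pos θstar hθ) (h_norm θstar hθ)
  have hmain := tendstoToNormal_sliced h_pos h_norm h_compact h_interior h_ident h_diff_log
    h_diff_score h_score_sq h_v_sq h_v_posDef h_v_four h_objective h_lip₁ h_lip₂ h_smooth h_inv
    hM h_sample h_est
  have hg := gradTerm_symm h_diff_log h_diff_score h_interior
  have hhess (h1 : secondMoment pv = 1) : hess (slicedObjective pm (pm θstar) pv) θstar =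
      hess (scoreMatchingObjective pm (pm θstar)) θstar := by
    refine hess_congr ?_
    filter_upwards [hΘ] with θ hθ using
      slicedObjective_eq_scoreMatchingObjective (memLp_norm_sq h_v_four) h1 (h_objective θ hθ)
  refine ⟨hmain, ?_, ?_⟩
  · rintro rfl
    have h1 := secondMoment_eq_one map_flip_stdGaussian (integral_sq_coord_stdGaussian (D := D))
    have h4 := fourthMoment_eq map_flip_stdGaussian
      (fun i j hij => fourthMoment_stdGaussian_of_ne hij)
      (fourthMoment_stdGaussian_self (D := D))
    rw [hhess h1, middleMatrix_eq h1 h4 hg] at hmain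
    convert! hmain using 3
    rw [add_zero]
    abel
  · rintro rfl
    have h1 := secondMoment_eq_one map_flip_rademacher (integral_sq_coord_rademacher (D := D))
    -- Coordinates are `±1`, so `𝔼 vᵢ⁴ = 1 = 3 + κ`. With `κ = -2` the coefficient `(2 + κ) / M` of
    -- `∑ᵢ Vᵢᵢ` vanishes.
    have h4 := fourthMoment_eq (κ := -2) map_flip_rademacher
      (fun i j _ => fourthMoment_rademacher i j)
      (fun i : Fin D => (fourthMoment_rademacher i i).trans (by norm_num))
    rw [hhess h1, middleMatrix_eq h1 h4 hg] at hmain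
    convert! hmain using 3
    simp
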